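/- Let $d\ge 1$, $1\le r\le n$, and let $\mathcal X=(X_{ij})$ and $\mathcal Y=(Y_{ij})$, $1\le i\le d$, $1\le j\le n$, be two standard Gaussian arrays, i.e. each array is jointly Gaussian with $N(0,1)$ entries. Assume that the columns of each array are independent in the sense that there are reals $\sigma^{(1)}_{il},\sigma^{(0)}_{il}$, $1\le i,l\le d$, with $$\mathbb E\{X_{ij}X_{lk}\}=\sigma^{(1)}_{il}\,\mathbb 1\{j=k\},\qquad \mathbb E\{Y_{ij}Y_{lk}\}=\sigma^{(0)}_{il}\,\mathbb 1\{j=k\},\qquad 1\le i,l\le d,\ 1\le j,k\le n.$$ Let $X_{i(r)}$ denote the $r$-th smallest of $X_{i1},\dots,X_{in}$, let $Y_{i(r)}$ be defined likewise, and for $\boldsymbol u=(u_1,\dots,u_d)$ put $$\Delta_{(r)}(\boldsymbol u)=\mathbb P\{X_{i(r)}\le u_i,\ 1\le i\le d\}-\mathbb P\{Y_{i(r)}\le u_i,\ 1\le i\le d\}.$$ Set $c_{n-1,r-1}=\binom{n-1}{r-1}$, $\rho_{il}=\max(|\sigma^{(0)}_{il}|,|\sigma^{(1)}_{il}|)$,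 $x_+=\max(x,0)$ and $$A^{(r)}_{il}=\int_{\sigma^{(0)}_{il}}^{\sigma^{(1)}_{il}}\frac{(1+|h|)^{2(n-r)}}{(1-h^2)^{(n-r+1)/2}}\,dh ,$$ an oriented integral of a nonnegative function, understood as $+\infty$ or $-\infty$ when it diverges (which can happen only if $\rho_{il}=1$). Then for every $\boldsymbol u\in(0,\infty)^d$, with $u=\min_{1\le i\le d}u_i$, $$\Delta_{(r)}(\boldsymbol u)\le \frac{n(c_{n-1,r-1})^2}{(2\pi)^{n-r+1}}\,u^{-2(n-r)}\sum_{1\le i<l\le d}\big(A^{(r)}_{il}\big)_+\exp\Big(-\frac{(n-r+1)u^2}{1+\rho_{il}}\Big)$$ and $$|\Delta_{(r)}(\boldsymbol u)|\le \frac{n(c_{n-1,r-1})^2}{(2\pi)^{n-r+1}}\,u^{-2(n-r)}\sum_{1\le i<l\le d}\big|A^{(r)}_{il}\big|\exp\Big(-\frac{(n-r+1)u^2}{1+\rho_{il}}\Big).$$ -/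

import Mathlib

open MeasureTheory ProbabilityTheory

noncomputable section

/-- A standard Gaussian `d × n` array: a jointly Gaussian family with `N(0,1)` entries. -/
structure IsStdGaussianArray {Ω : Type*} [MeasurableSpace Ω] {d n : ℕ}
    (X : Fin d → Fin n → Ω → ℝ) (P : Measure Ω) : Prop where
  gaussian : HasGaussianLaw (fun ω (p : Fin d × Fin n) => X p.1 p.2 ω) P
  standard : ∀ i j, HasLaw (X i j) (gaussianReal 0 1) P

/-- The `r`-th order statistic (`r`-th smallest entry, `1 ≤ r ≤ n`) of `x`. -/
def orderStat {n : ℕ} (x : Fin n → ℝ) (r : ℕ) (h₁ : 1 ≤ r) (h₂ : r ≤ n) : ℝ :=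
  x (Tuple.sort x ⟨r - 1, by omega⟩)

/-- `P (X_(r) ≤ u)`, where `X_(r)` is the vector of the `r`-th order statistics of the rows. -/
def orderStatCDF {Ω : Type*} [MeasurableSpace Ω] {d n : ℕ}
    (X : Fin d → Fin n → Ω → ℝ) (P : Measure Ω) (r : ℕ) (h₁ : 1 ≤ r) (h₂ : r ≤ n)
    (u : Fin d → ℝ) : ℝ :=
  P.real {ω | ∀ i, orderStat (fun j => X i j ω) r h₁ h₂ ≤ u i}

/-- The nonnegative integrand `(1 + |h|)^(2(n-r)) / (1 - h²)^((n-r+1)/2)`, for `|h| ≤ 1`. -/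
def compIntegrand (n r : ℕ) (h : ℝ) : ℝ :=
  (1 + |h|) ^ (2 * (n - r)) / (1 - h ^ 2) ^ (((n : ℝ) - r + 1) / 2)

/-- The oriented integral of `compIntegrand n r` from `a` to `b`. It is extended real valued,
because the integrand need not be integrable near `±1`; one of the two terms of the
difference is always `0`. -/
def compIntegral (n r : ℕ) (a b : ℝ) : EReal :=
  ((∫⁻ h in Set.Ioc a b, ENNReal.ofReal (compIntegrand n r h) : ENNReal) : EReal)
    - ((∫⁻ h in Set.Ioc b a, ENNReal.ofReal (compIntegrand n r h) : ENNReal) : EReal)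

/-- The factor `n * C(n-1, r-1)² / (2π)^(n-r+1) * v^(-2(n-r))`. -/
def compConst (n r : ℕ) (v : ℝ) : ℝ :=
  n * ((n - 1).choose (r - 1) : ℝ) ^ 2 / (2 * Real.pi) ^ (n - r + 1) * (v ^ (2 * (n - r)))⁻¹

end

noncomputable section

namespace GaussianComparison

/-! The argument is a normal comparison by Gaussian interpolation, applied to a smoothed counting
event. The event that every row has its `r`-th order statistic below its level says that each row
has at least `r` entries below that level. Its indicator is `rowPoly` evaluated at the indicators of
the single entries, a polynomial affine in each variable. The entry indicators are replaced by
smooth decreasing cutoffs, and the limit is taken at the end.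

On the product space the rotation `cos θ · Y + sin θ · X` joins `Y` to `X` with unit variances
throughout. Differentiating in `θ` and integrating by parts (`integral_sub_integral_eq`) leaves a
sum over pairs of entries of `sin θ cos θ (S₁ - S₀)` times the expectation of two cutoff derivatives
and a second-order slope of `rowPoly`. Only pairs in one column and in two different rows survive.
Their expectations are nonnegative, so for an upper bound each covariance difference may be replaced
by its positive part.

For rows `i`, `l` and column `j`, the slope of one row's counting polynomial is the probability that
exactly `r - 1` of the other entries lie below the level. It is bounded by `C(n-1, r-1)` products of
`n - r` tail factors. The columns are independent, so the expectation factorizes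
(`integral_prod_columnFactor_le`). Column `j` contributes the bound `pairBound` for the bivariate
density on a quadrant, and a column carrying tail factors from both rows contributes `tailBound`. A
tail factor from one row only costs at most the square root of `tailBound`, so every choice of index
sets gives `pairBound * tailBound ^ (n - r)`.

Summing over the `n` columns and over both orders of a pair of rows, and substituting `h = sin² θ σ₁
+ cos² θ σ₀`, turns the angular integral into the integral of `compIntegrand`. The estimates are
made in `ENNReal`, where a divergent integral is harmless. The bound on the absolute value follows
by exchanging the arrays. -/

/-! ### Gaussian integration by parts -/

theorem hasDerivAt_gaussianPDFReal_std (x : ℝ) :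
    HasDerivAt (gaussianPDFReal 0 1) (-(x * gaussianPDFReal 0 1 x)) x := by
  have h : HasDerivAt (fun x : ℝ => -(x - 0) ^ 2 / (2 * 1)) (-x) x := by
    have := (((hasDerivAt_id x).sub_const 0).pow 2).neg.div_const (2 * 1)
    convert! this using 1
    simp only [id, Nat.cast_ofNat]
    ring
  have h2 := (h.exp).const_mul ((√(2 * Real.pi * 1))⁻¹)
  have e : gaussianPDFReal 0 1
      = fun x : ℝ => (√(2 * Real.pi * 1))⁻¹ * Real.exp (-(x - 0) ^ 2 / (2 * 1)) := by
    rw [gaussianPDFReal_def]; simp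
  rw [e]
  convert! h2 using 1
  ring

theorem integrable_of_continuous_of_bound {α : Type*} [TopologicalSpace α] [MeasurableSpace α]
    [OpensMeasurableSpace α] [SecondCountableTopology α] {μ : Measure α} [IsFiniteMeasure μ]
    {f : α → ℝ} (hf : Continuous f) {C : ℝ} (hC : ∀ x, |f x| ≤ C) : Integrable f μ :=
  Integrable.of_bound hf.aestronglyMeasurable C (ae_of_all _ fun x => by simpa using hC x)

/-- Gaussian integration by parts on the line. -/
theorem integral_mul_gaussianReal_eq {k k' : ℝ → ℝ} (hk : ∀ x, HasDerivAt k (k' x) x)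
    (hk' : Continuous k') {C C' : ℝ} (hC : ∀ x, |k x| ≤ C) (hC' : ∀ x, |k' x| ≤ C') :
    ∫ x, x * k x ∂(gaussianReal 0 1) = ∫ x, k' x ∂(gaussianReal 0 1) := by
  have hkc : Continuous k := continuous_iff_continuousAt.2 fun x => (hk x).continuousAt
  have hpc : Continuous (gaussianPDFReal 0 1) :=
    continuous_iff_continuousAt.2 fun x => (hasDerivAt_gaussianPDFReal_std x).continuousAt
  have hpi : Integrable (gaussianPDFReal 0 1) := integrable_gaussianPDFReal 0 1
  have hxp : Integrable (fun x => x * gaussianPDFReal 0 1 x) := by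
    have h : Integrable (fun x : ℝ => x) (gaussianReal 0 1) :=
      (memLp_id_gaussianReal (μ := 0) (v := 1) 1).integrable le_rfl
    rw [gaussianReal_of_var_ne_zero _ one_ne_zero,
      integrable_withDensity_iff (measurable_gaussianPDF 0 1)
        (ae_of_all _ fun _ => gaussianPDF_lt_top)] at h
    simpa [toReal_gaussianPDF] using h
  -- The standard density satisfies `φ' = -x φ`, so the factor `x` is a derivative falling on the
  -- density.
  have key := integral_mul_deriv_eq_deriv_mul_of_integrable (u := k) (v := gaussianPDFReal 0 1)
    (u' := k') (v' := fun x => -(x * gaussianPDFReal 0 1 x)) (fun x _ => hk x)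
    (fun x _ => hasDerivAt_gaussianPDFReal_std x)
    (hxp.neg.bdd_mul (c := C) hkc.aestronglyMeasurable (ae_of_all _ hC))
    (hpi.bdd_mul (c := C') hk'.aestronglyMeasurable (ae_of_all _ hC'))
    (hpi.bdd_mul (c := C) hkc.aestronglyMeasurable (ae_of_all _ hC))
  rw [integral_gaussianReal_eq_integral_smul one_ne_zero,
    integral_gaussianReal_eq_integral_smul one_ne_zero]
  simp only [smul_eq_mul]
  have e1 : ∫ x, gaussianPDFReal 0 1 x * (x * k x) = - ∫ x, k x * -(x * gaussianPDFReal 0 1 x) := by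
    rw [← integral_neg]; congr 1; ext x; ring
  rw [e1, key, neg_neg]
  congr 1; ext x; ring

/-- Gaussian integration by parts for a standard normal variable `U` and a jointly Gaussian
vector `Z`. -/
theorem integral_mul_comp_eq_of_hasGaussianLaw {Ω ι : Type*} [MeasurableSpace Ω] [Fintype ι]
    {P : Measure Ω} [IsProbabilityMeasure P] {U : Ω → ℝ} {Z : Ω → ι → ℝ}
    (hUZ : HasGaussianLaw (fun ω => (U ω, Z ω)) P) (hU : HasLaw U (gaussianReal 0 1) P)
    {c : ι → ℝ} (hc : ∀ b, ∫ ω, U ω * Z ω b ∂P = c b) {G G' : (ι → ℝ) → ℝ}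
    (hG : ∀ x t, HasDerivAt (fun t : ℝ => G (x + t • c)) (G' (x + t • c)) t)
    (hGc : Continuous G) (hG'c : Continuous G') {C C' : ℝ} (hC : ∀ x, |G x| ≤ C)
    (hC' : ∀ x, |G' x| ≤ C') :
    ∫ ω, U ω * G (Z ω) ∂P = ∫ ω, G' (Z ω) ∂P := by
  have hZ : HasGaussianLaw Z P := hUZ.snd
  have hU0 : ∫ ω, U ω ∂P = 0 := by
    have := hU.integral_eq
    simpa using this
  have hUm : MemLp U 2 P := hUZ.fst.memLp_two
  have hZm : ∀ b, MemLp (fun ω => Z ω b) 2 P := fun b => (hZ.eval b).memLp_two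
  have hU2 : cov[U, U; P] = 1 := by
    rw [covariance_self hU.aemeasurable, hU.variance_eq, variance_id_gaussianReal]; simp
  -- The residual of the regression of `Z` on `U`; the coefficients are the covariances `c` because
  -- `U` has unit variance. It is uncorrelated with `U`, hence independent, and with `R` fixed the
  -- claim is the one-dimensional formula along the direction `c`.
  let R : Ω → ι → ℝ := fun ω b => Z ω b - U ω * c b
  have hUR : HasGaussianLaw (fun ω => (fun _ : Unit => U ω, R ω)) P := by
    let Lm : ℝ × (ι → ℝ) →L[ℝ] (Unit → ℝ) × (ι → ℝ) :=
      (ContinuousLinearMap.pi fun _ => ContinuousLinearMap.fst ℝ ℝ (ι → ℝ)).prod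
        (ContinuousLinearMap.pi fun b =>
          (ContinuousLinearMap.proj b).comp (ContinuousLinearMap.snd ℝ ℝ (ι → ℝ))
            - (c b) • ContinuousLinearMap.fst ℝ ℝ (ι → ℝ))
    have := hUZ.map_fun Lm
    convert! this using 2 with ω
    simp only [Lm, ContinuousLinearMap.prod_apply, Prod.mk.injEq]
    refine ⟨by ext; simp, ?_⟩
    ext b
    simp [R, mul_comm]
  have hind : IndepFun U R P := by
    have h := HasGaussianLaw.indepFun_of_covariance_eval (X := fun _ : Unit => U)
      (Y := fun b ω => R ω b) hUR (fun _ b => by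
        have e : (fun ω => R ω b) = (fun ω => Z ω b) - (fun ω => U ω * c b) := rfl
        rw [e, covariance_sub_right hUm (hZm b) (hUm.mul_const _), covariance_mul_const_right, hU2,
          covariance_eq_sub hUm (hZm b), hU0]
        simp only [Pi.mul_apply]
        rw [hc b]; ring)
    exact h.comp (φ := fun x : Unit → ℝ => x ()) (ψ := id) (by fun_prop) measurable_id
  have hRm : AEMeasurable R P := hUR.snd.aemeasurable
  have hlaw : HasLaw (fun ω => (U ω, R ω)) ((gaussianReal 0 1).prod (P.map R)) P :=
    (indepFun_iff_hasLaw_prodMk_prod hU ⟨hRm, rfl⟩).1 hind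
  have : IsProbabilityMeasure (P.map R) := Measure.isProbabilityMeasure_map hRm
  have hZR : ∀ ω, Z ω = R ω + U ω • c := fun ω => by ext b; simp [R]
  have hid : Integrable (fun x : ℝ => x) (gaussianReal 0 1) :=
    (memLp_id_gaussianReal (μ := 0) (v := 1) 1).integrable le_rfl
  have i1 : Integrable (fun p : ℝ × (ι → ℝ) => p.1 * G (p.2 + p.1 • c))
      ((gaussianReal 0 1).prod (P.map R)) := by
    have h1 : Integrable (fun p : ℝ × (ι → ℝ) => p.1) ((gaussianReal 0 1).prod (P.map R)) :=
      hid.comp_fst _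
    exact h1.mul_bdd (c := C) (by fun_prop) (ae_of_all _ fun p => hC _)
  have i2 : Integrable (fun p : ℝ × (ι → ℝ) => G' (p.2 + p.1 • c))
      ((gaussianReal 0 1).prod (P.map R)) :=
    integrable_of_continuous_of_bound (by fun_prop) (C := C') fun p => hC' _
  have e1 : ∫ ω, U ω * G (Z ω) ∂P = ∫ p, p.1 * G (p.2 + p.1 • c)
      ∂((gaussianReal 0 1).prod (P.map R)) := by
    rw [← hlaw.integral_comp i1.aestronglyMeasurable]
    refine integral_congr_ae (ae_of_all _ fun ω => ?_)
    simp only [Function.comp, ← hZR]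
  have e2 : ∫ ω, G' (Z ω) ∂P = ∫ p, G' (p.2 + p.1 • c)
      ∂((gaussianReal 0 1).prod (P.map R)) := by
    rw [← hlaw.integral_comp i2.aestronglyMeasurable]
    refine integral_congr_ae (ae_of_all _ fun ω => ?_)
    simp only [Function.comp, ← hZR]
  rw [e1, e2, integral_prod_symm _ i1, integral_prod_symm _ i2]
  congr 1
  ext x
  exact integral_mul_gaussianReal_eq (k := fun t => G (x + t • c))
    (k' := fun t => G' (x + t • c)) (hG x) (by fun_prop) (fun t => hC _) (fun t => hC' _)

/-! ### Functions affine in each coordinate -/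

section MultiAffine

variable {ι : Type*}

/-- A continuous function is bounded on the unit cube. -/
theorem exists_bound_cube {F : (ι → ℝ) → ℝ} (hF : Continuous F) :
    ∃ C, 0 ≤ C ∧ ∀ y : ι → ℝ, (∀ a, y a ∈ Set.Icc (0 : ℝ) 1) → |F y| ≤ C := by
  obtain ⟨C, hC⟩ := (isCompact_univ_pi fun _ : ι => isCompact_Icc (a := (0 : ℝ)) (b := 1))
    |>.exists_bound_of_continuousOn hF.continuousOn
  refine ⟨|C|, abs_nonneg _, fun y hy => ?_⟩
  have := hC y (by rw [Set.mem_univ_pi]; exact hy)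
  exact (by simpa using this : |F y| ≤ C).trans (le_abs_self C)

variable [DecidableEq ι]

/-- The difference of the values of `F` at `1` and `0` in the coordinate `a`. -/
def slopeAt (F : (ι → ℝ) → ℝ) (a : ι) (y : ι → ℝ) : ℝ :=
  F (Function.update y a 1) - F (Function.update y a 0)

/-- Smooth functions that are affine in each coordinate. -/
structure MultiAffine [Fintype ι] (F : (ι → ℝ) → ℝ) : Prop where
  contDiff : ContDiff ℝ 1 F
  affine : ∀ a y t, F (Function.update y a t) = F (Function.update y a 0) + t * slopeAt F a y

variable [Fintype ι]

theorem contDiff_update_const (a : ι) (t : ℝ) :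
    ContDiff ℝ 1 (fun y : ι → ℝ => Function.update y a t) := by
  rw [contDiff_pi]
  intro b
  by_cases h : b = a
  · subst h; simpa using contDiff_const
  · simpa [h] using contDiff_apply ℝ ℝ b

/-- A slope is constant in its own coordinate and affine in every other one, so slopes can be
iterated. -/
theorem MultiAffine.slopeAt {F : (ι → ℝ) → ℝ} (hF : MultiAffine F) (a : ι) :
    MultiAffine (slopeAt F a) where
  contDiff := (hF.contDiff.comp (contDiff_update_const a 1)).sub
    (hF.contDiff.comp (contDiff_update_const a 0))
  affine b y t := by
    by_cases h : b = a
    · subst h; simp [GaussianComparison.slopeAt]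
    · have e : ∀ s r, Function.update (Function.update y b s) a r
          = Function.update (Function.update y a r) b s := fun s r => Function.update_comm h s r y
      simp only [GaussianComparison.slopeAt, e]
      rw [hF.affine b (Function.update y a 1) t, hF.affine b (Function.update y a 0) t]
      simp only [GaussianComparison.slopeAt]
      ring

theorem MultiAffine.continuous {F : (ι → ℝ) → ℝ} (hF : MultiAffine F) : Continuous F :=
  hF.contDiff.continuous

/-- Along a coordinate line the function is affine, so its derivative there is a finite difference.
This turns analytic partial derivatives into combinatorial quantities. -/
theorem MultiAffine.fderiv_single {F : (ι → ℝ) → ℝ} (hF : MultiAffine F) (a : ι) (y : ι → ℝ) :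
    fderiv ℝ F y (Pi.single a 1) = GaussianComparison.slopeAt F a y := by
  have h1 : HasFDerivAt F (fderiv ℝ F y) (Function.update y a (y a)) := by
    rw [Function.update_eq_self]
    exact (hF.contDiff.differentiable one_ne_zero y).hasFDerivAt
  have h2 := h1.comp_hasDerivAt (y a) (hasDerivAt_update y a (y a))
  have h3 : HasDerivAt (F ∘ Function.update y a) (GaussianComparison.slopeAt F a y) (y a) := by
    have : F ∘ Function.update y a
        = fun t => F (Function.update y a 0) + t * GaussianComparison.slopeAt F a y := by
      ext t; exact hF.affine a y t
    rw [this]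
    simpa using ((hasDerivAt_id (y a)).mul_const (GaussianComparison.slopeAt F a y)).const_add
      (F (Function.update y a 0))
  exact h2.unique h3

theorem MultiAffine.hasDerivAt_comp {F : (ι → ℝ) → ℝ} (hF : MultiAffine F) {y : ℝ → ι → ℝ}
    {y' : ι → ℝ} {t : ℝ} (hy : ∀ a, HasDerivAt (fun t => y t a) (y' a) t) :
    HasDerivAt (fun t => F (y t)) (∑ a, y' a * GaussianComparison.slopeAt F a (y t)) t := by
  have h1 := (hF.contDiff.differentiable one_ne_zero (y t)).hasFDerivAt
  have h2 := h1.comp_hasDerivAt t (hasDerivAt_pi.2 hy)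
  convert! h2 using 1
  conv_rhs => rw [← Finset.univ_sum_single y', map_sum]
  refine Finset.sum_congr rfl fun a _ => ?_
  rw [← hF.fderiv_single, ← smul_eq_mul, ← map_smul]
  congr 1
  ext b
  by_cases h : b = a
  · subst h; simp
  · simp [h]

end MultiAffine

/-- Bounded `C¹` cutoffs with values in the unit interval. -/
structure IsCutoff (ψ ψ' : ℝ → ℝ) : Prop where
  hasDerivAt : ∀ x, HasDerivAt ψ (ψ' x) x
  continuous_deriv : Continuous ψ'
  bound : ∃ C, 0 ≤ C ∧ ∀ x, |ψ' x| ≤ C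
  mem : ∀ x, ψ x ∈ Set.Icc (0 : ℝ) 1

theorem IsCutoff.continuous {ψ ψ' : ℝ → ℝ} (h : IsCutoff ψ ψ') : Continuous ψ :=
  continuous_iff_continuousAt.2 fun x => (h.hasDerivAt x).continuousAt

/-! ### Trigonometric interpolation between two Gaussian measures -/

section Interpolation

variable {ι : Type*}

/-- Trigonometric interpolation between two points. -/
def interp (θ : ℝ) (w : (ι → ℝ) × (ι → ℝ)) : ι → ℝ :=
  fun a => Real.cos θ * w.2 a + Real.sin θ * w.1 a

/-- The derivative of `interp` in the angle. -/
def interpDeriv (θ : ℝ) (w : (ι → ℝ) × (ι → ℝ)) : ι → ℝ :=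
  fun a => Real.cos θ * w.1 a - Real.sin θ * w.2 a

theorem hasDerivAt_interp (w : (ι → ℝ) × (ι → ℝ)) (a : ι) (θ : ℝ) :
    HasDerivAt (fun θ => interp θ w a) (interpDeriv θ w a) θ := by
  have h := ((Real.hasDerivAt_cos θ).mul_const (w.2 a)).add
    ((Real.hasDerivAt_sin θ).mul_const (w.1 a))
  convert! h using 1
  simp only [interpDeriv]; ring

theorem continuous_interp : Continuous fun p : ℝ × ((ι → ℝ) × (ι → ℝ)) => interp p.1 p.2 := by
  unfold interp; fun_prop

theorem continuous_interpDeriv (a : ι) :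
    Continuous fun p : ℝ × ((ι → ℝ) × (ι → ℝ)) => interpDeriv p.1 p.2 a := by
  unfold interpDeriv; fun_prop

/-- A centered Gaussian measure on `ι → ℝ` with unit variances and second moments `S`. -/
structure IsStdGaussian (μ : Measure (ι → ℝ)) (S : ι → ι → ℝ) : Prop where
  isGaussian : IsGaussian μ
  mean : ∀ a, ∫ x, x a ∂μ = 0
  moment : ∀ a b, ∫ x, x a * x b ∂μ = S a b
  diag : ∀ a, S a a = 1

variable {μ₁ μ₀ : Measure (ι → ℝ)} {S₁ S₀ : ι → ι → ℝ}

theorem IsStdGaussian.memLp (h : IsStdGaussian μ₁ S₁) (a : ι) : MemLp (fun x => x a) 2 μ₁ := by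
  have := h.isGaussian
  exact ((IsGaussian.hasGaussianLaw_id (μ := μ₁)).eval a).memLp_two

variable [Fintype ι]

theorem hasGaussianLaw_prod (h₁ : IsStdGaussian μ₁ S₁) (h₀ : IsStdGaussian μ₀ S₀) :
    HasGaussianLaw (fun w : (ι → ℝ) × (ι → ℝ) => w) (μ₁.prod μ₀) := by
  have := h₁.isGaussian
  have := h₀.isGaussian
  exact IsGaussian.hasGaussianLaw_id

/-- The mixed terms vanish because the two components are independent and centered. All covariances
of the rotation and of its derivative are instances. -/
theorem integral_prod_combination (h₁ : IsStdGaussian μ₁ S₁) (h₀ : IsStdGaussian μ₀ S₀)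
    (α β γ δ : ℝ) (a b : ι) :
    ∫ w, (α * w.1 a + β * w.2 a) * (γ * w.1 b + δ * w.2 b) ∂(μ₁.prod μ₀)
      = α * γ * S₁ a b + β * δ * S₀ a b := by
  have := h₁.isGaussian
  have := h₀.isGaussian
  have i11 : Integrable (fun w : (ι → ℝ) × (ι → ℝ) => w.1 a * w.1 b) (μ₁.prod μ₀) :=
    ((h₁.memLp a).integrable_mul (h₁.memLp b)).comp_fst _
  have i00 : Integrable (fun w : (ι → ℝ) × (ι → ℝ) => w.2 a * w.2 b) (μ₁.prod μ₀) :=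
    ((h₀.memLp a).integrable_mul (h₀.memLp b)).comp_snd _
  have j1 : ∀ c, Integrable (fun x : ι → ℝ => x c) μ₁ := fun c =>
    (h₁.memLp c).integrable (by norm_num)
  have j0 : ∀ c, Integrable (fun x : ι → ℝ => x c) μ₀ := fun c =>
    (h₀.memLp c).integrable (by norm_num)
  have i10 : Integrable (fun w : (ι → ℝ) × (ι → ℝ) => w.1 a * w.2 b) (μ₁.prod μ₀) :=
    (j1 a).mul_prod (j0 b)
  have i01 : Integrable (fun w : (ι → ℝ) × (ι → ℝ) => w.1 b * w.2 a) (μ₁.prod μ₀) :=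
    (j1 b).mul_prod (j0 a)
  have e : ∀ w : (ι → ℝ) × (ι → ℝ), (α * w.1 a + β * w.2 a) * (γ * w.1 b + δ * w.2 b)
      = (α * γ) * (w.1 a * w.1 b) + (β * δ) * (w.2 a * w.2 b) + (α * δ) * (w.1 a * w.2 b)
        + (β * γ) * (w.1 b * w.2 a) := fun w => by ring
  simp only [e]
  rw [integral_add (by exact ((i11.const_mul _).add (i00.const_mul _)).add (i10.const_mul _))
      (i01.const_mul _),
    integral_add (by exact (i11.const_mul _).add (i00.const_mul _)) (i10.const_mul _),
    integral_add (i11.const_mul _) (i00.const_mul _)]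
  simp only [integral_const_mul]
  rw [integral_prod_mul (μ := μ₁) (ν := μ₀) (fun x => x a) (fun x => x b),
    integral_prod_mul (μ := μ₁) (ν := μ₀) (fun x => x b) (fun x => x a), h₁.mean, h₁.mean,
    integral_fun_fst (μ := μ₁) (ν := μ₀) (fun x => x a * x b),
    integral_fun_snd (μ := μ₁) (ν := μ₀) (fun x => x a * x b), h₁.moment, h₀.moment]
  simp

theorem integral_prod_linear (h₁ : IsStdGaussian μ₁ S₁) (h₀ : IsStdGaussian μ₀ S₀)
    (α β : ℝ) (a : ι) : ∫ w, (α * w.1 a + β * w.2 a) ∂(μ₁.prod μ₀) = 0 := by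
  have := h₁.isGaussian
  have := h₀.isGaussian
  have j1 : Integrable (fun w : (ι → ℝ) × (ι → ℝ) => w.1 a) (μ₁.prod μ₀) :=
    ((h₁.memLp a).integrable (by norm_num)).comp_fst _
  have j0 : Integrable (fun w : (ι → ℝ) × (ι → ℝ) => w.2 a) (μ₁.prod μ₀) :=
    ((h₀.memLp a).integrable (by norm_num)).comp_snd _
  rw [integral_add (j1.const_mul _) (j0.const_mul _)]
  simp only [integral_const_mul]
  rw [integral_fun_fst (μ := μ₁) (ν := μ₀) (fun x => x a),
    integral_fun_snd (μ := μ₁) (ν := μ₀) (fun x => x a), h₁.mean, h₀.mean]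
  simp

theorem hasLaw_gaussianReal_std {Ω : Type*} [MeasurableSpace Ω] {P : Measure Ω} {U : Ω → ℝ}
    (hU : HasGaussianLaw U P) (h0 : ∫ ω, U ω ∂P = 0) (h2 : ∫ ω, U ω * U ω ∂P = 1) :
    HasLaw U (gaussianReal 0 1) P where
  aemeasurable := hU.aemeasurable
  map_eq := by
    have := hU.isProbabilityMeasure
    rw [hU.map_eq_gaussianReal, h0, ← covariance_self hU.aemeasurable,
      covariance_eq_sub hU.memLp_two hU.memLp_two, h0]
    simp only [Pi.mul_apply]
    rw [h2]; simp

theorem hasGaussianLaw_interpDeriv_interp (h₁ : IsStdGaussian μ₁ S₁) (h₀ : IsStdGaussian μ₀ S₀)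
    (θ : ℝ) (a : ι) :
    HasGaussianLaw (fun w => (interpDeriv θ w a, interp θ w)) (μ₁.prod μ₀) := by
  let Lm : (ι → ℝ) × (ι → ℝ) →L[ℝ] ℝ × (ι → ℝ) :=
    (Real.cos θ • (ContinuousLinearMap.proj a).comp (ContinuousLinearMap.fst ℝ (ι → ℝ) (ι → ℝ))
      - Real.sin θ • (ContinuousLinearMap.proj a).comp
        (ContinuousLinearMap.snd ℝ (ι → ℝ) (ι → ℝ))).prod
      (Real.cos θ • ContinuousLinearMap.snd ℝ (ι → ℝ) (ι → ℝ)
        + Real.sin θ • ContinuousLinearMap.fst ℝ (ι → ℝ) (ι → ℝ))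
  have := (hasGaussianLaw_prod h₁ h₀).map_fun Lm
  convert! this using 2 with w

theorem hasGaussianLaw_interp (h₁ : IsStdGaussian μ₁ S₁) (h₀ : IsStdGaussian μ₀ S₀)
    (θ : ℝ) : HasGaussianLaw (fun w => interp θ w) (μ₁.prod μ₀) := by
  let Lm : (ι → ℝ) × (ι → ℝ) →L[ℝ] (ι → ℝ) :=
      (Real.cos θ • ContinuousLinearMap.snd ℝ (ι → ℝ) (ι → ℝ)
        + Real.sin θ • ContinuousLinearMap.fst ℝ (ι → ℝ) (ι → ℝ))
  have := (hasGaussianLaw_prod h₁ h₀).map_fun Lm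
  convert! this using 2 with w

theorem integral_interp (h₁ : IsStdGaussian μ₁ S₁) (h₀ : IsStdGaussian μ₀ S₀) (θ : ℝ) (a : ι) :
    ∫ w, interp θ w a ∂(μ₁.prod μ₀) = 0 := by
  rw [← integral_prod_linear h₁ h₀ (Real.sin θ) (Real.cos θ) a]
  congr 1; ext w; simp only [interp]; ring

theorem integral_interp_mul_interp (h₁ : IsStdGaussian μ₁ S₁) (h₀ : IsStdGaussian μ₀ S₀)
    (θ : ℝ) (a b : ι) : ∫ w, interp θ w a * interp θ w b ∂(μ₁.prod μ₀)
      = Real.sin θ ^ 2 * S₁ a b + Real.cos θ ^ 2 * S₀ a b := by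
  rw [sq, sq, ← integral_prod_combination h₁ h₀ (Real.sin θ) (Real.cos θ) (Real.sin θ) (Real.cos θ)]
  congr 1; ext w; simp only [interp]; ring

theorem integral_interpDeriv_mul_interp (h₁ : IsStdGaussian μ₁ S₁) (h₀ : IsStdGaussian μ₀ S₀)
    (θ : ℝ) (a b : ι) : ∫ w, interpDeriv θ w a * interp θ w b ∂(μ₁.prod μ₀)
      = Real.sin θ * Real.cos θ * (S₁ a b - S₀ a b) := by
  have := integral_prod_combination h₁ h₀ (Real.cos θ) (-Real.sin θ) (Real.sin θ) (Real.cos θ) a b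
  rw [show Real.sin θ * Real.cos θ * (S₁ a b - S₀ a b) = Real.cos θ * Real.sin θ * S₁ a b
    + -Real.sin θ * Real.cos θ * S₀ a b by ring, ← this]
  congr 1; ext w; simp only [interp, interpDeriv]; ring

theorem hasLaw_interp (h₁ : IsStdGaussian μ₁ S₁) (h₀ : IsStdGaussian μ₀ S₀) (θ : ℝ) (a : ι) :
    HasLaw (fun w => interp θ w a) (gaussianReal 0 1) (μ₁.prod μ₀) := by
  refine hasLaw_gaussianReal_std ((hasGaussianLaw_interp h₁ h₀ θ).eval a)
    (integral_interp h₁ h₀ θ a) ?_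
  rw [integral_interp_mul_interp h₁ h₀, h₁.diag, h₀.diag, mul_one, mul_one, Real.sin_sq_add_cos_sq]

theorem hasLaw_interpDeriv (h₁ : IsStdGaussian μ₁ S₁) (h₀ : IsStdGaussian μ₀ S₀)
    (θ : ℝ) (a : ι) :
    HasLaw (fun w => interpDeriv θ w a) (gaussianReal 0 1) (μ₁.prod μ₀) := by
  refine hasLaw_gaussianReal_std (hasGaussianLaw_interpDeriv_interp h₁ h₀ θ a).fst ?_ ?_
  · rw [← integral_prod_linear h₁ h₀ (Real.cos θ) (-Real.sin θ) a]
    congr 1; ext w; simp only [interpDeriv]; ring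
  · have := integral_prod_combination h₁ h₀ (Real.cos θ) (-Real.sin θ) (Real.cos θ)
      (-Real.sin θ) a a
    rw [h₁.diag, h₀.diag] at this
    rw [← Real.cos_sq_add_sin_sq θ]
    convert! this using 1
    · congr 1; ext w; simp only [interpDeriv]; ring
    · ring

variable [DecidableEq ι]

/-- One summand of the derivative in `θ`, after integration by parts against the standard normal
variable `interpDeriv θ w a`. -/
theorem integral_interpDeriv_mul_cutoff (h₁ : IsStdGaussian μ₁ S₁) (h₀ : IsStdGaussian μ₀ S₀)
    {F : (ι → ℝ) → ℝ} (hF : MultiAffine F) {ψ ψ' : ι → ℝ → ℝ} (hψ : ∀ a, IsCutoff (ψ a) (ψ' a))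
    (θ : ℝ) (a : ι) :
    ∫ w, interpDeriv θ w a * (ψ' a (interp θ w a) * slopeAt F a (fun b => ψ b (interp θ w b)))
      ∂(μ₁.prod μ₀)
    = ∑ b, Real.sin θ * Real.cos θ * (S₁ a b - S₀ a b) *
      ∫ w, ψ' a (interp θ w a) * ψ' b (interp θ w b) *
        slopeAt (slopeAt F a) b (fun c => ψ c (interp θ w c)) ∂(μ₁.prod μ₀) := by
  have := h₁.isGaussian
  have := h₀.isGaussian
  set c : ι → ℝ := fun b => Real.sin θ * Real.cos θ * (S₁ a b - S₀ a b) with hc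
  -- Both measures have unit variances, so the direction `c` does not move the coordinate `a`. The
  -- factor `ψ' a` is therefore never differentiated, and `C¹` cutoffs suffice.
  have hca : c a = 0 := by simp [hc, h₁.diag, h₀.diag]
  have hψc : ∀ b, Continuous (ψ b) := fun b => (hψ b).continuous
  have hψ'c : ∀ b, Continuous (ψ' b) := fun b => (hψ b).continuous_deriv
  have hΨ : Continuous fun x : ι → ℝ => fun b => ψ b (x b) :=
    continuous_pi fun b => (hψc b).comp (continuous_apply b)
  obtain ⟨C, hC0, hC⟩ := exists_bound_cube (hF.slopeAt a).continuous
  choose B hB0 hB using fun b => (hψ b).bound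
  choose D hD0 hD using fun b => exists_bound_cube ((hF.slopeAt a).slopeAt b).continuous
  have hbd : ∀ b (x : ι → ℝ), |ψ' a (x a) * ψ' b (x b) *
      slopeAt (slopeAt F a) b (fun c => ψ c (x c))| ≤ B a * B b * D b := by
    intro b x
    rw [abs_mul, abs_mul]
    gcongr
    · exact mul_nonneg (hB0 _) (hB0 _)
    · exact hB0 _
    · exact hB _ _
    · exact hB _ _
    · exact hD _ _ fun c => (hψ c).mem _
  have hcont : ∀ b, Continuous fun x : ι → ℝ => ψ' a (x a) * ψ' b (x b) *
      slopeAt (slopeAt F a) b (fun c => ψ c (x c)) := fun b =>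
    (((hψ'c a).comp (continuous_apply a)).mul ((hψ'c b).comp (continuous_apply b))).mul
      (((hF.slopeAt a).slopeAt b).continuous.comp hΨ)
  have key := integral_mul_comp_eq_of_hasGaussianLaw
    (G := fun x => ψ' a (x a) * slopeAt F a (fun b => ψ b (x b)))
    (G' := fun x => ∑ b, c b * (ψ' a (x a) * ψ' b (x b) *
      slopeAt (slopeAt F a) b (fun c => ψ c (x c))))
    (C := B a * C) (C' := ∑ b, |c b| * (B a * B b * D b))
    (hasGaussianLaw_interpDeriv_interp h₁ h₀ θ a)
    (hasLaw_interpDeriv h₁ h₀ θ a) (c := c) (fun b => integral_interpDeriv_mul_interp h₁ h₀ θ a b)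
    ?_ ?_ ?_ ?_ ?_
  · rw [key, integral_finsetSum]
    · simp only [integral_const_mul, hc]
    · intro b _
      have hci : Continuous fun w : (ι → ℝ) × (ι → ℝ) => interp θ w :=
        continuous_interp.comp (Continuous.prodMk_right θ)
      exact (integrable_of_continuous_of_bound ((hcont b).comp hci)
        (C := B a * B b * D b) fun w => hbd b _).const_mul _
  · intro x t
    have hd := (hF.slopeAt a).hasDerivAt_comp (t := t)
      (y := fun t b => ψ b ((x + t • c) b)) (y' := fun b => ψ' b ((x + t • c) b) * c b) (fun b => by
        refine ((hψ b).hasDerivAt _).comp t ?_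
        simpa using ((hasDerivAt_id t).mul_const (c b)).const_add (x b))
    have hd2 := hd.const_mul (ψ' a (x a))
    have hxa : ∀ t : ℝ, (x + t • c) a = x a := fun t => by simp [hca]
    simp only [hxa]
    convert! hd2 using 1
    rw [Finset.mul_sum]
    refine Finset.sum_congr rfl fun b _ => ?_
    ring
  · exact ((hψ'c a).comp (continuous_apply a)).mul ((hF.slopeAt a).continuous.comp hΨ)
  · exact continuous_finsetSum _ fun b _ => continuous_const.mul (hcont b)
  · intro x
    rw [abs_mul]
    exact mul_le_mul (hB _ _) (hC _ fun c => (hψ c).mem _) (abs_nonneg _) (hB0 _)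
  · intro x
    refine (Finset.abs_sum_le_sum_abs _ _).trans (Finset.sum_le_sum fun b _ => ?_)
    rw [abs_mul]
    exact mul_le_mul_of_nonneg_left (hbd b x) (abs_nonneg _)

/-- The Gaussian interpolation formula for smoothed multi-affine functions. -/
theorem integral_sub_integral_eq (h₁ : IsStdGaussian μ₁ S₁) (h₀ : IsStdGaussian μ₀ S₀)
    {F : (ι → ℝ) → ℝ} (hF : MultiAffine F) {ψ ψ' : ι → ℝ → ℝ} (hψ : ∀ a, IsCutoff (ψ a) (ψ' a)) :
    ∫ x, F (fun a => ψ a (x a)) ∂μ₁ - ∫ x, F (fun a => ψ a (x a)) ∂μ₀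
    = ∫ θ in (0 : ℝ)..(Real.pi / 2), ∑ a, ∑ b, Real.sin θ * Real.cos θ * (S₁ a b - S₀ a b) *
      ∫ w, ψ' a (interp θ w a) * ψ' b (interp θ w b) *
        slopeAt (slopeAt F a) b (fun c => ψ c (interp θ w c)) ∂(μ₁.prod μ₀) := by
  have := h₁.isGaussian
  have := h₀.isGaussian
  have hψc : ∀ b, Continuous (ψ b) := fun b => (hψ b).continuous
  have hψ'c : ∀ b, Continuous (ψ' b) := fun b => (hψ b).continuous_deriv
  have hΨ : Continuous fun x : ι → ℝ => fun b => ψ b (x b) :=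
    continuous_pi fun b => (hψc b).comp (continuous_apply b)
  choose B hB0 hB using fun b => (hψ b).bound
  choose D hD0 hD using fun b => exists_bound_cube (hF.slopeAt b).continuous
  obtain ⟨C, hC0, hC⟩ := exists_bound_cube hF.continuous
  let T : ι → ℝ → (ι → ℝ) × (ι → ℝ) → ℝ := fun a θ w =>
    interpDeriv θ w a * (ψ' a (interp θ w a) * slopeAt F a (fun b => ψ b (interp θ w b)))
  have hTc : ∀ a, Continuous fun p : ℝ × ((ι → ℝ) × (ι → ℝ)) => T a p.1 p.2 := fun a =>
    (continuous_interpDeriv a).mul (((hψ'c a).comp ((continuous_apply a).comp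
      continuous_interp)).mul ((hF.slopeAt a).continuous.comp (hΨ.comp continuous_interp)))
  have hTsum : Continuous fun p : ℝ × ((ι → ℝ) × (ι → ℝ)) => ∑ a, T a p.1 p.2 := by
    clear_value T
    exact continuous_finsetSum _ fun a _ => hTc a
  have hTsw : ∀ w, Continuous fun θ : ℝ => ∑ a, T a θ w := by
    clear_value T
    intro w
    have h : Continuous fun θ : ℝ => (θ, w) := by fun_prop
    exact hTsum.comp h
  have hTb : ∀ a θ w, |T a θ w| ≤ (|w.1 a| + |w.2 a|) * (B a * D a) := by
    intro a θ w
    simp only [T]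
    rw [abs_mul, abs_mul]
    have h1 : |interpDeriv θ w a| ≤ |w.1 a| + |w.2 a| := by
      refine (abs_sub _ _).trans ?_
      rw [abs_mul, abs_mul]
      exact add_le_add (mul_le_of_le_one_left (abs_nonneg _) (Real.abs_cos_le_one θ))
        (mul_le_of_le_one_left (abs_nonneg _) (Real.abs_sin_le_one θ))
    have h2 := hD a (fun b => ψ b (interp θ w b)) fun c => (hψ c).mem _
    have h3 := hB a (interp θ w a)
    have := hB0 a
    gcongr
  have hW : ∀ a, Integrable (fun w : (ι → ℝ) × (ι → ℝ) => (|w.1 a| + |w.2 a|) * (B a * D a))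
      (μ₁.prod μ₀) := fun a => by
    refine Integrable.mul_const (Integrable.add ?_ ?_) _
    · exact (((h₁.memLp a).integrable (by norm_num)).abs).comp_fst _
    · exact (((h₀.memLp a).integrable (by norm_num)).abs).comp_snd _
  have hTi : ∀ a θ, Integrable (T a θ) (μ₁.prod μ₀) := fun a θ =>
    (hW a).mono' ((hTc a).comp (Continuous.prodMk_right θ)).aestronglyMeasurable
      (ae_of_all _ fun w => hTb a θ w)
  -- The rotation equals `w.2` at angle `0` and `w.1` at angle `π / 2`, so the difference is the
  -- integral of the derivative for each `w`; Fubini then exchanges the integrals.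
  have hftc : ∀ w : (ι → ℝ) × (ι → ℝ), F (fun a => ψ a (w.1 a)) - F (fun a => ψ a (w.2 a))
      = ∫ θ in (0 : ℝ)..(Real.pi / 2), ∑ a, T a θ w := by
    intro w
    have hd : ∀ θ : ℝ, HasDerivAt (fun θ => F (fun a => ψ a (interp θ w a))) (∑ a, T a θ w) θ := by
      intro θ
      have := hF.hasDerivAt_comp (t := θ) (y := fun θ a => ψ a (interp θ w a))
        (y' := fun a => ψ' a (interp θ w a) * interpDeriv θ w a)
        (fun a => ((hψ a).hasDerivAt _).comp θ (hasDerivAt_interp w a θ))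
      convert! this using 1
      refine Finset.sum_congr rfl fun a _ => ?_
      simp only [T]; ring
    rw [intervalIntegral.integral_eq_sub_of_hasDerivAt (fun θ _ => hd θ)]
    · simp [interp]
    · refine Continuous.intervalIntegrable ?_ _ _
      exact hTsw w
  have hFi1 : Integrable (fun x : ι → ℝ => F (fun a => ψ a (x a))) μ₁ :=
    integrable_of_continuous_of_bound (hF.continuous.comp hΨ) fun x => hC _ fun c => (hψ c).mem _
  have hFi0 : Integrable (fun x : ι → ℝ => F (fun a => ψ a (x a))) μ₀ :=
    integrable_of_continuous_of_bound (hF.continuous.comp hΨ) fun x => hC _ fun c => (hψ c).mem _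
  have hLHS : ∫ x, F (fun a => ψ a (x a)) ∂μ₁ - ∫ x, F (fun a => ψ a (x a)) ∂μ₀
      = ∫ w, (F (fun a => ψ a (w.1 a)) - F (fun a => ψ a (w.2 a))) ∂(μ₁.prod μ₀) := by
    rw [integral_sub (hFi1.comp_fst _) (hFi0.comp_snd _),
      integral_fun_fst (μ := μ₁) (ν := μ₀) (fun x => F (fun a => ψ a (x a))),
      integral_fun_snd (μ := μ₁) (ν := μ₀) (fun x => F (fun a => ψ a (x a)))]
    simp
  have hint : Integrable (fun p : ℝ × ((ι → ℝ) × (ι → ℝ)) => ∑ a, T a p.1 p.2)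
      ((volume.restrict (Set.uIoc 0 (Real.pi / 2))).prod (μ₁.prod μ₀)) := by
    clear_value T
    have : IsFiniteMeasure (volume.restrict (Set.uIoc 0 (Real.pi / 2))) := by
      unfold Set.uIoc; infer_instance
    refine Integrable.mono' (g := fun p => ∑ a, (|p.2.1 a| + |p.2.2 a|) * (B a * D a))
      (integrable_finsetSum _ fun a _ => (hW a).comp_snd _) hTsum.aestronglyMeasurable
      (ae_of_all _ fun p => ?_)
    exact (norm_sum_le _ _).trans (Finset.sum_le_sum fun a _ => hTb a p.1 p.2)
  have hswap := intervalIntegral_integral_swap (f := fun θ w => ∑ a, T a θ w) hint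
  rw [hLHS, integral_congr_ae (ae_of_all _ hftc), ← hswap]
  refine intervalIntegral.integral_congr fun θ _ => ?_
  change ∫ w, ∑ a, T a θ w ∂(μ₁.prod μ₀) = _
  rw [integral_finsetSum _ fun a _ => hTi a θ]
  exact Finset.sum_congr rfl fun a _ => integral_interpDeriv_mul_cutoff h₁ h₀ hF hψ θ a

end Interpolation

/-! ### The counting polynomial of one row -/

section CountPoly

variable {κ : Type*} [DecidableEq κ]

theorem factor_mem {y : κ → ℝ} (hy : ∀ k, y k ∈ Set.Icc (0 : ℝ) 1) (T : Finset κ) (k : κ) :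
    0 ≤ if k ∈ T then y k else 1 - y k := by
  have := hy k
  simp only [Set.mem_Icc] at this
  split_ifs <;> linarith

variable [Fintype κ]

/-- The probability that at least `r` of independent events with probabilities `y k` occur. -/
def countPoly (r : ℕ) (y : κ → ℝ) : ℝ :=
  ∑ S : Finset κ with r ≤ S.card, ∏ k, if k ∈ S then y k else 1 - y k

theorem contDiff_countPoly (r : ℕ) : ContDiff ℝ 1 (countPoly (κ := κ) r) := by
  refine ContDiff.sum fun S _ => contDiff_prod fun k _ => ?_
  split_ifs
  · exact contDiff_apply ℝ ℝ k
  · exact contDiff_const.sub (contDiff_apply ℝ ℝ k)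

theorem prod_update_eq (S : Finset κ) (y : κ → ℝ) (j : κ) (t : ℝ) :
    (∏ k, if k ∈ S then Function.update y j t k else 1 - Function.update y j t k)
      = (if j ∈ S then t else 1 - t) *
        ∏ k ∈ Finset.univ.erase j, if k ∈ S then y k else 1 - y k := by
  rw [← Finset.mul_prod_erase _ _ (Finset.mem_univ j)]
  congr 1
  · simp
  · refine Finset.prod_congr rfl fun k hk => ?_
    simp [Finset.ne_of_mem_erase hk]

theorem multiAffine_countPoly (r : ℕ) : MultiAffine (countPoly (κ := κ) r) where
  contDiff := contDiff_countPoly r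
  affine j y t := by
    simp only [slopeAt, countPoly, prod_update_eq]
    rw [← Finset.sum_sub_distrib, Finset.mul_sum, ← Finset.sum_add_distrib]
    refine Finset.sum_congr rfl fun S _ => ?_
    split_ifs <;> ring

/-- Event `j` is pivotal exactly when `r - 1` of the other events occur. In the proof the sets
containing `j` are matched with `T = S.erase j`; the conditions `r ≤ T.card + 1` and `r ≤ T.card`
then cancel except when `T.card + 1 = r`. -/
theorem slopeAt_countPoly (r : ℕ) (j : κ) (y : κ → ℝ) :
    slopeAt (countPoly r) j y = ∑ T : Finset κ with j ∉ T ∧ T.card + 1 = r,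
      ∏ k ∈ Finset.univ.erase j, if k ∈ T then y k else 1 - y k := by
  simp only [slopeAt, countPoly, prod_update_eq]
  set Q : Finset κ → ℝ := fun T => ∏ k ∈ Finset.univ.erase j, if k ∈ T then y k else 1 - y k
    with hQ
  have h1 : ∑ S : Finset κ with r ≤ S.card, (if j ∈ S then (1 : ℝ) else 1 - 1) * Q S
      = ∑ T : Finset κ with j ∉ T, if r ≤ T.card + 1 then Q T else 0 := by
    rw [← Finset.sum_filter, Finset.filter_filter]
    have : ∑ S : Finset κ with r ≤ S.card, (if j ∈ S then (1 : ℝ) else 1 - 1) * Q S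
        = ∑ S : Finset κ with r ≤ S.card ∧ j ∈ S, Q S := by
      rw [← Finset.filter_filter, Finset.sum_filter (fun S => j ∈ S)]
      refine Finset.sum_congr rfl fun S _ => ?_
      split_ifs <;> simp
    rw [this]
    refine Finset.sum_nbij' (fun S => S.erase j) (fun T => insert j T) ?_ ?_ ?_ ?_ ?_
    · intro S hS
      simp only [Finset.mem_filter, Finset.mem_univ, true_and] at hS ⊢
      exact ⟨Finset.notMem_erase _ _, by rw [Finset.card_erase_add_one hS.2]; exact hS.1⟩
    · intro T hT
      simp only [Finset.mem_filter, Finset.mem_univ, true_and] at hT ⊢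
      exact ⟨by rw [Finset.card_insert_of_notMem hT.1]; exact hT.2, Finset.mem_insert_self _ _⟩
    · intro S hS
      simp only [Finset.mem_filter, Finset.mem_univ, true_and] at hS
      exact Finset.insert_erase hS.2
    · intro T hT
      simp only [Finset.mem_filter, Finset.mem_univ, true_and] at hT
      exact Finset.erase_insert hT.1
    · intro S _
      refine Finset.prod_congr rfl fun k hk => ?_
      simp [Finset.ne_of_mem_erase hk]
  have h0 : ∑ S : Finset κ with r ≤ S.card, (if j ∈ S then (0 : ℝ) else 1 - 0) * Q S
      = ∑ T : Finset κ with j ∉ T, if r ≤ T.card then Q T else 0 := by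
    rw [Finset.sum_filter, Finset.sum_filter]
    refine Finset.sum_congr rfl fun S _ => ?_
    split_ifs <;> simp_all
  rw [h1, h0, ← Finset.sum_sub_distrib, ← Finset.filter_filter, Finset.sum_filter (fun T => _ + 1 = r)]
  refine Finset.sum_congr rfl fun S _ => ?_
  by_cases h : S.card + 1 = r
  · have h2 : ¬ r ≤ S.card := by omega
    simp [h, h2, hQ]
  · by_cases h2 : r ≤ S.card
    · have : r ≤ S.card + 1 := by omega
      simp [h, h2, this]
    · have : ¬ r ≤ S.card + 1 := by omega
      simp [h, h2, this]

/-- The summands are some of the nonnegative terms in the expansion of `∏ (y k + (1 - y k)) = 1`. -/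
theorem countPoly_mem {y : κ → ℝ} (hy : ∀ k, y k ∈ Set.Icc (0 : ℝ) 1) (r : ℕ) :
    countPoly r y ∈ Set.Icc (0 : ℝ) 1 := by
  refine ⟨Finset.sum_nonneg fun S _ => Finset.prod_nonneg fun k _ => factor_mem hy S k, ?_⟩
  calc countPoly r y ≤ ∑ S : Finset κ, ∏ k, if k ∈ S then y k else 1 - y k :=
        Finset.sum_le_sum_of_subset_of_nonneg (Finset.filter_subset _ _)
          fun S _ _ => Finset.prod_nonneg fun k _ => factor_mem hy S k
    _ = ∏ k, (y k + (1 - y k)) := by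
        rw [Finset.prod_add, Finset.powerset_univ]
        refine Finset.sum_congr rfl fun S _ => ?_
        rw [Finset.prod_ite]
        congr 1
        · congr 1; ext k; simp
        · congr 1; ext k; simp
    _ = 1 := by simp

theorem slopeAt_countPoly_nonneg {y : κ → ℝ} (hy : ∀ k, y k ∈ Set.Icc (0 : ℝ) 1) (r : ℕ) (j : κ) :
    0 ≤ slopeAt (countPoly r) j y := by
  rw [slopeAt_countPoly]
  exact Finset.sum_nonneg fun S _ => Finset.prod_nonneg fun k _ => factor_mem hy S k

/-- Only the tail factors `1 - y k` are small; the factors indexed by `T` are discarded. -/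
theorem slopeAt_countPoly_le {y : κ → ℝ} (hy : ∀ k, y k ∈ Set.Icc (0 : ℝ) 1) (r : ℕ) (j : κ) :
    slopeAt (countPoly r) j y ≤ ∑ T : Finset κ with j ∉ T ∧ T.card + 1 = r,
      ∏ k ∈ Finset.univ.erase j, if k ∈ T then 1 else 1 - y k := by
  rw [slopeAt_countPoly]
  refine Finset.sum_le_sum fun T _ => Finset.prod_le_prod (fun k _ => factor_mem hy T k) ?_
  intro k _
  split_ifs
  · exact (hy k).2
  · exact le_rfl

theorem card_filter_notMem (r : ℕ) (hr : 1 ≤ r) (j : κ) :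
    (Finset.univ.filter fun T : Finset κ => j ∉ T ∧ T.card + 1 = r).card
      = (Fintype.card κ - 1).choose (r - 1) := by
  have : (Finset.univ.filter fun T : Finset κ => j ∉ T ∧ T.card + 1 = r)
      = (Finset.univ.erase j).powersetCard (r - 1) := by
    ext T
    simp only [Finset.mem_filter, Finset.mem_univ, true_and, Finset.mem_powersetCard,
      Finset.subset_erase, Finset.subset_univ, true_and]
    exact and_congr_right fun _ => by omega
  rw [this, Finset.card_powersetCard, Finset.card_erase_of_mem (Finset.mem_univ _),
    Finset.card_univ]

/-- At a vertex of the cube only the summand `S = A` survives. -/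
theorem countPoly_indicator (r : ℕ) (A : Finset κ) :
    countPoly r (fun k => if k ∈ A then (1 : ℝ) else 0) = if r ≤ A.card then 1 else 0 := by
  have h : ∀ S : Finset κ, (∏ k, if k ∈ S then (if k ∈ A then (1 : ℝ) else 0)
      else 1 - (if k ∈ A then (1 : ℝ) else 0)) = if S = A then 1 else 0 := by
    intro S
    split_ifs with h
    · subst h
      exact Finset.prod_eq_one fun k _ => by split_ifs <;> simp
    · obtain ⟨k, hk⟩ : ∃ k, ¬ (k ∈ S ↔ k ∈ A) := by
        by_contra hc
        push Not at hc
        exact h (Finset.ext hc)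
      refine Finset.prod_eq_zero (Finset.mem_univ k) ?_
      by_cases h1 : k ∈ S <;> by_cases h2 : k ∈ A <;> simp_all
  simp only [countPoly, h]
  rw [Finset.sum_ite_eq']
  simp

end CountPoly

/-! ### The product over rows and its second-order slopes -/

section RowProduct

variable {d n : ℕ}

/-- The product over the rows of `countPoly`. -/
def rowPoly (r : ℕ) (y : Fin d × Fin n → ℝ) : ℝ :=
  ∏ i, countPoly r fun j => y (i, j)

theorem row_update (y : Fin d × Fin n → ℝ) (i : Fin d) (j : Fin n) (t : ℝ) :
    (fun k => Function.update y (i, j) t (i, k)) = Function.update (fun k => y (i, k)) j t := by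
  ext k
  by_cases h : k = j
  · subst h; simp
  · simp [h]

theorem row_update_of_ne (y : Fin d × Fin n → ℝ) {i m : Fin d} (h : m ≠ i) (j : Fin n) (t : ℝ) :
    (fun k => Function.update y (i, j) t (m, k)) = fun k => y (m, k) := by
  ext k
  simp [h]

theorem rowPoly_update (r : ℕ) (y : Fin d × Fin n → ℝ) (i : Fin d) (j : Fin n) (t : ℝ) :
    rowPoly r (Function.update y (i, j) t) = countPoly r (Function.update (fun k => y (i, k)) j t) *
      ∏ m ∈ Finset.univ.erase i, countPoly r fun k => y (m, k) := by
  rw [rowPoly, ← Finset.mul_prod_erase _ _ (Finset.mem_univ i), row_update]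
  congr 1
  refine Finset.prod_congr rfl fun m hm => ?_
  rw [row_update_of_ne y (Finset.ne_of_mem_erase hm)]

theorem slopeAt_rowPoly (r : ℕ) (y : Fin d × Fin n → ℝ) (i : Fin d) (j : Fin n) :
    slopeAt (rowPoly r) (i, j) y = slopeAt (countPoly r) j (fun k => y (i, k)) *
      ∏ m ∈ Finset.univ.erase i, countPoly r fun k => y (m, k) := by
  rw [slopeAt, rowPoly_update, rowPoly_update, slopeAt]; ring

theorem multiAffine_rowPoly (r : ℕ) : MultiAffine (rowPoly (d := d) (n := n) r) where
  contDiff := contDiff_prod fun i _ => (contDiff_countPoly r).comp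
    (contDiff_pi.2 fun j => contDiff_apply ℝ ℝ (i, j))
  affine a y t := by
    obtain ⟨i, j⟩ := a
    rw [rowPoly_update, rowPoly_update, slopeAt_rowPoly, (multiAffine_countPoly r).affine j _ t]
    ring

/-- Distinct rows are distinct factors of the product, so each slope acts on its own factor. -/
theorem slopeAt_slopeAt_rowPoly (r : ℕ) (y : Fin d × Fin n → ℝ) {i l : Fin d} (h : i ≠ l)
    (j j' : Fin n) :
    slopeAt (slopeAt (rowPoly r) (i, j)) (l, j') y = slopeAt (countPoly r) j (fun k => y (i, k)) *
      slopeAt (countPoly r) j' (fun k => y (l, k)) *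
      ∏ m ∈ (Finset.univ.erase i).erase l, countPoly r fun k => y (m, k) := by
  have e : ∀ t, slopeAt (rowPoly r) (i, j) (Function.update y (l, j') t)
      = slopeAt (countPoly r) j (fun k => y (i, k)) *
        (countPoly r (Function.update (fun k => y (l, k)) j' t) *
        ∏ m ∈ (Finset.univ.erase i).erase l, countPoly r fun k => y (m, k)) := by
    intro t
    rw [slopeAt_rowPoly, row_update_of_ne y h, ← Finset.mul_prod_erase (Finset.univ.erase i) _
      (Finset.mem_erase.2 ⟨h.symm, Finset.mem_univ l⟩), row_update]
    congr 2
    refine Finset.prod_congr rfl fun m hm => ?_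
    rw [row_update_of_ne y (Finset.ne_of_mem_erase hm)]
  rw [slopeAt, e, e]
  simp only [slopeAt]
  ring

theorem slopeAt_slopeAt_rowPoly_mem (r : ℕ) {y : Fin d × Fin n → ℝ}
    (hy : ∀ a, y a ∈ Set.Icc (0 : ℝ) 1) {i l : Fin d} (h : i ≠ l) (j j' : Fin n) :
    slopeAt (slopeAt (rowPoly r) (i, j)) (l, j') y ∈ Set.Icc (0 : ℝ)
      (slopeAt (countPoly r) j (fun k => y (i, k)) *
        slopeAt (countPoly r) j' (fun k => y (l, k))) := by
  rw [slopeAt_slopeAt_rowPoly r y h]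
  have h1 := slopeAt_countPoly_nonneg (fun k => hy (i, k)) r j
  have h2 := slopeAt_countPoly_nonneg (fun k => hy (l, k)) r j'
  have h3 : ∀ m, countPoly r (fun k => y (m, k)) ∈ Set.Icc (0 : ℝ) 1 := fun m =>
    countPoly_mem (fun k => hy (m, k)) r
  have h4 := Finset.prod_nonneg fun m (_ : m ∈ (Finset.univ.erase i).erase l) => (h3 m).1
  have h5 := Finset.prod_le_one (s := (Finset.univ.erase i).erase l) (fun m _ => (h3 m).1)
    fun m _ => (h3 m).2
  exact ⟨mul_nonneg (mul_nonneg h1 h2) h4, mul_le_of_le_one_right (mul_nonneg h1 h2) h5⟩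

end RowProduct

/-! ### Quadrant bounds for a correlated Gaussian pair -/

section Pair

/-- Since `x * y ≥ 0`, one may replace `h` by `|h|` in the cross term. The resulting form is convex
and lies above its tangent plane at `(v, v)`, which is the left side. The linear lower bound makes
the density bound a product in `x` and `y`. -/
theorem bivariate_exponent_le {h v x y : ℝ} (hh : |h| < 1) (hv : 0 < v) (hx : v ≤ x) (hy : v ≤ y) :
    v ^ 2 / (1 + |h|) + v * (x - v) / (1 + |h|) + v * (y - v) / (1 + |h|)
      ≤ x ^ 2 / 2 + (y - h * x) ^ 2 / (2 * (1 - h ^ 2)) := by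
  have h0 := abs_nonneg h
  have h1 : (1 : ℝ) - h ^ 2 = (1 - |h|) * (1 + |h|) := by rw [← sq_abs]; ring
  have h2 : 0 < 1 - |h| := by linarith
  have h3 : 0 < 1 + |h| := by linarith
  have e1 : v ^ 2 / (1 + |h|) + v * (x - v) / (1 + |h|) + v * (y - v) / (1 + |h|)
      = (2 * (1 - |h|) * v * (x + y - v)) / (2 * ((1 - |h|) * (1 + |h|))) := by
    field_simp; ring
  have e2 : x ^ 2 / 2 + (y - h * x) ^ 2 / (2 * (1 - h ^ 2))
      = (x ^ 2 - 2 * h * x * y + y ^ 2) / (2 * ((1 - |h|) * (1 + |h|))) := by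
    have : (1 - |h|) * (1 + |h|) ≠ 0 := by positivity
    rw [h1]
    rw [div_add_div _ _ two_ne_zero (by positivity), div_eq_div_iff (by positivity) (by positivity)]
    have h4 : |h| ^ 2 = h ^ 2 := sq_abs h
    have : (1 - |h|) * (1 + |h|) = 1 - h ^ 2 := h1.symm
    rw [this]; ring
  rw [e1, e2]
  gcongr
  have hxy : 0 ≤ x * y := mul_nonneg (hv.le.trans hx) (hv.le.trans hy)
  have h5 : h * (x * y) ≤ |h| * (x * y) := mul_le_mul_of_nonneg_right (le_abs_self h) hxy
  nlinarith [sq_nonneg (x - y), mul_nonneg h0 (sq_nonneg (x - y)), mul_nonneg h2.le (sq_nonneg (x - v)),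
    mul_nonneg h2.le (sq_nonneg (y - v)), mul_nonneg h2.le (mul_nonneg (sub_nonneg.2 hx) (sub_nonneg.2 hy))]

/-- The maximum of the bound for the bivariate normal density on `[v, ∞)²`. -/
def pairBound (h v : ℝ) : ℝ :=
  Real.exp (-(v ^ 2 / (1 + |h|))) / (2 * Real.pi * √(1 - h ^ 2))

/-- The exponential weight at rate `v / (1 + |h|)` beyond `v`. -/
def expWeight (h v x : ℝ) : ℝ := Real.exp (-(v * (x - v) / (1 + |h|)))

theorem pairBound_nonneg (h v : ℝ) : 0 ≤ pairBound h v := by unfold pairBound; positivity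

theorem expWeight_nonneg (h v x : ℝ) : 0 ≤ expWeight h v x := (Real.exp_pos _).le

theorem measurable_expWeight (h v : ℝ) : Measurable (expWeight h v) := by
  unfold expWeight; fun_prop

theorem gaussianPDFReal_mul_le {h v x y : ℝ} (hh : |h| < 1) (hv : 0 < v) (hx : v ≤ x)
    (hy : v ≤ y) :
    gaussianPDFReal 0 1 x * gaussianPDFReal (h * x) (1 - h ^ 2).toNNReal y
      ≤ pairBound h v * expWeight h v x * expWeight h v y := by
  have hs : 0 < 1 - h ^ 2 := by
    have := sq_lt_one_iff_abs_lt_one h |>.2 hh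
    linarith
  simp only [gaussianPDFReal_def, pairBound, expWeight, Real.coe_toNNReal _ hs.le]
  have e : √(2 * Real.pi * ((1 : NNReal) : ℝ)) * √(2 * Real.pi * (1 - h ^ 2))
      = 2 * Real.pi * √(1 - h ^ 2) := by
    rw [NNReal.coe_one, mul_one, Real.sqrt_mul (by positivity) (1 - h ^ 2), ← mul_assoc,
      Real.mul_self_sqrt (by positivity)]
  have e1 : ∀ A B : ℝ, (√(2 * Real.pi * ((1 : NNReal) : ℝ)))⁻¹ * A *
      ((√(2 * Real.pi * (1 - h ^ 2)))⁻¹ * B) = (2 * Real.pi * √(1 - h ^ 2))⁻¹ * (A * B) := by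
    intro A B; rw [← e, mul_inv]; ring
  have e2 : ∀ A B C D : ℝ, Real.exp A / D * Real.exp B * Real.exp C
      = D⁻¹ * Real.exp (A + B + C) := by
    intro A B C D; rw [Real.exp_add, Real.exp_add]; ring
  rw [e1, ← Real.exp_add, e2]
  refine mul_le_mul_of_nonneg_left (Real.exp_le_exp.2 ?_) (by positivity)
  have := bivariate_exponent_le hh hv hx hy
  simp only [NNReal.coe_one, sub_zero, mul_one, neg_div]
  linarith

theorem lintegral_expWeight {h v : ℝ} (hv : 0 < v) :
    ∫⁻ x in Set.Ioi v, ENNReal.ofReal (expWeight h v x) = ENNReal.ofReal ((1 + |h|) / v) := by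
  have hg : 0 < 1 + |h| := by positivity
  have ha : -(v / (1 + |h|)) < 0 := by
    have : 0 < v / (1 + |h|) := by positivity
    linarith
  have e : expWeight h v = fun x => Real.exp (v ^ 2 / (1 + |h|)) *
      Real.exp (-(v / (1 + |h|)) * x) := by
    ext x
    rw [expWeight, ← Real.exp_add]
    congr 1; field_simp; ring
  rw [← ofReal_integral_eq_lintegral_ofReal]
  · rw [e, integral_const_mul, integral_exp_mul_Ioi ha]
    congr 1
    rw [neg_div_neg_eq, div_div_eq_mul_div, ← mul_div_assoc, ← mul_assoc, ← Real.exp_add]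
    have : v ^ 2 / (1 + |h|) + -(v / (1 + |h|)) * v = 0 := by field_simp; ring
    rw [this]; simp
  · rw [e]
    exact (integrableOn_exp_mul_Ioi ha v).const_mul _
  · exact ae_of_all _ fun x => expWeight_nonneg h v x

theorem lintegral_gaussianReal {μ : ℝ} {s : NNReal} (hs : s ≠ 0) {f : ℝ → ENNReal}
    (hf : Measurable f) : ∫⁻ x, f x ∂(gaussianReal μ s) = ∫⁻ x, gaussianPDF μ s x * f x := by
  rw [gaussianReal_of_var_ne_zero _ hs,
    lintegral_withDensity_eq_lintegral_mul _ (measurable_gaussianPDF μ s) hf]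
  rfl

/-- The joint law of `U` and `V - h U` for a standard Gaussian pair of correlation `h`. -/
theorem hasLaw_regression {Ω : Type*} [MeasurableSpace Ω] {P : Measure Ω} {U V : Ω → ℝ} {h : ℝ}
    (hUV : HasGaussianLaw (fun ω => (U ω, V ω)) P) (hU : HasLaw U (gaussianReal 0 1) P)
    (hV : HasLaw V (gaussianReal 0 1) P) (hh : ∫ ω, U ω * V ω ∂P = h) :
    HasLaw (fun ω => (U ω, V ω - h * U ω))
      ((gaussianReal 0 1).prod (gaussianReal 0 (1 - h ^ 2).toNNReal)) P := by
  have := hUV.isProbabilityMeasure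
  have hUm : MemLp U 2 P := hUV.fst.memLp_two
  have hVm : MemLp V 2 P := hUV.snd.memLp_two
  have hU0 : ∫ ω, U ω ∂P = 0 := by simpa using hU.integral_eq
  have hV0 : ∫ ω, V ω ∂P = 0 := by simpa using hV.integral_eq
  have hU2 : cov[U, U; P] = 1 := by
    rw [covariance_self hU.aemeasurable, hU.variance_eq, variance_id_gaussianReal]; simp
  have hV2 : cov[V, V; P] = 1 := by
    rw [covariance_self hV.aemeasurable, hV.variance_eq, variance_id_gaussianReal]; simp
  have hUVc : cov[U, V; P] = h := by
    rw [covariance_eq_sub hUm hVm, hU0]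
    simp only [Pi.mul_apply]
    rw [hh]; ring
  have hG : HasGaussianLaw (fun ω => (U ω, V ω - h * U ω)) P := by
    let Lm : ℝ × ℝ →L[ℝ] ℝ × ℝ := (ContinuousLinearMap.fst ℝ ℝ ℝ).prod
      (ContinuousLinearMap.snd ℝ ℝ ℝ - h • ContinuousLinearMap.fst ℝ ℝ ℝ)
    have := hUV.map_fun Lm
    convert! this using 2 with ω
  have hc : cov[U, fun ω => V ω - h * U ω; P] = 0 := by
    rw [covariance_fun_sub_right hUm hVm (hUm.const_mul h), covariance_const_mul_right, hUVc, hU2]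
    ring
  have hind := hG.indepFun_of_covariance_eq_zero hc
  have hW : HasLaw (fun ω => V ω - h * U ω) (gaussianReal 0 (1 - h ^ 2).toNNReal) P :=
    { aemeasurable := hG.snd.aemeasurable
      map_eq := by
        rw [hG.snd.map_eq_gaussianReal, ← covariance_self hG.snd.aemeasurable,
          covariance_fun_sub_fun_sub hVm (hUm.const_mul h) hVm (hUm.const_mul h),
          covariance_const_mul_right, covariance_const_mul_left, covariance_const_mul_left,
          covariance_const_mul_right, covariance_comm V U, hUVc, hU2, hV2,
          integral_sub (hVm.integrable (by norm_num)) ((hUm.integrable (by norm_num)).const_mul h),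
          integral_const_mul, hU0, hV0]
        congr 2 <;> ring }
  exact (indepFun_iff_hasLaw_prodMk_prod hU hW).1 hind

/-- The joint density is the marginal density of `U` times the conditional density of `V`. As `f`
and `g` vanish below `v`, only its product bound on the quadrant matters, and the double integral
splits. -/
theorem lintegral_pair_le {Ω : Type*} [MeasurableSpace Ω] {P : Measure Ω} {U V : Ω → ℝ} {h v : ℝ}
    (hUV : HasGaussianLaw (fun ω => (U ω, V ω)) P) (hU : HasLaw U (gaussianReal 0 1) P)
    (hV : HasLaw V (gaussianReal 0 1) P) (hh : ∫ ω, U ω * V ω ∂P = h) (hh1 : |h| < 1)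
    (hv : 0 < v) {f g : ℝ → ENNReal} (hf : Measurable f) (hg : Measurable g)
    (hf0 : ∀ x, x < v → f x = 0) (hg0 : ∀ x, x < v → g x = 0) :
    ∫⁻ ω, f (U ω) * g (V ω) ∂P ≤ ENNReal.ofReal (pairBound h v) *
      (∫⁻ x, ENNReal.ofReal (expWeight h v x) * f x) *
      (∫⁻ x, ENNReal.ofReal (expWeight h v x) * g x) := by
  have hs : 0 < 1 - h ^ 2 := by
    have := sq_lt_one_iff_abs_lt_one h |>.2 hh1
    linarith
  set s : NNReal := (1 - h ^ 2).toNNReal with hsdef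
  have hs0 : s ≠ 0 := by simpa [hsdef] using hs
  have hlaw := hasLaw_regression hUV hU hV hh
  have e0 : ∫⁻ ω, f (U ω) * g (V ω) ∂P
      = ∫⁻ p, f p.1 * g (h * p.1 + p.2) ∂((gaussianReal 0 1).prod (gaussianReal 0 s)) := by
    rw [← hlaw.lintegral_comp (by fun_prop)]
    refine lintegral_congr fun ω => ?_
    simp only [add_sub_cancel]
  rw [e0, lintegral_prod _ (by fun_prop)]
  have e1 : ∀ x, ∫⁻ y, f x * g (h * x + y) ∂(gaussianReal 0 s)
      = f x * ∫⁻ y, gaussianPDF (h * x) s y * g y := by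
    intro x
    rw [lintegral_const_mul _ (by fun_prop)]
    congr 1
    rw [← lintegral_gaussianReal hs0 hg]
    have := gaussianReal_map_const_add (μ := 0) (v := s) (h * x)
    rw [zero_add] at this
    rw [← this, lintegral_map hg (by fun_prop)]
  simp only [e1]
  rw [lintegral_gaussianReal one_ne_zero]
  · have hwm : Measurable fun x => ENNReal.ofReal (expWeight h v x) :=
      (measurable_expWeight h v).ennreal_ofReal
    have hwg : Measurable fun x => ENNReal.ofReal (expWeight h v x) * g x := hwm.mul hg
    have hwf : Measurable fun x => ENNReal.ofReal (expWeight h v x) * f x := hwm.mul hf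
    rw [mul_assoc, mul_comm (lintegral _ _), ← mul_assoc, ← lintegral_const_mul _ hwf]
    refine lintegral_mono fun x => ?_
    simp only
    by_cases hx : x < v
    · simp [hf0 x hx]
    push Not at hx
    calc gaussianPDF 0 1 x * (f x * ∫⁻ y, gaussianPDF (h * x) s y * g y)
        = f x * ∫⁻ y, gaussianPDF 0 1 x * (gaussianPDF (h * x) s y * g y) := by
          have hpg : Measurable fun y => gaussianPDF (h * x) s y * g y :=
            (measurable_gaussianPDF _ _).mul hg
          rw [lintegral_const_mul _ hpg, mul_left_comm]
      _ ≤ f x * ∫⁻ y, ENNReal.ofReal (pairBound h v) * ENNReal.ofReal (expWeight h v x) *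
            (ENNReal.ofReal (expWeight h v y) * g y) := by
          refine mul_le_mul_right (lintegral_mono fun y => ?_) _
          simp only
          by_cases hy : y < v
          · simp [hg0 y hy]
          push Not at hy
          rw [← mul_assoc, ← mul_assoc]
          refine mul_le_mul_left ?_ _
          rw [gaussianPDF, gaussianPDF, ← ENNReal.ofReal_mul (gaussianPDFReal_nonneg _ _ _),
            ← ENNReal.ofReal_mul (pairBound_nonneg h v),
            ← ENNReal.ofReal_mul (mul_nonneg (pairBound_nonneg h v) (expWeight_nonneg h v x))]
          exact ENNReal.ofReal_le_ofReal (gaussianPDFReal_mul_le hh1 hv hx hy)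
      _ = ENNReal.ofReal (pairBound h v) *
            (∫⁻ y, ENNReal.ofReal (expWeight h v y) * g y) *
            (ENNReal.ofReal (expWeight h v x) * f x) := by
          rw [lintegral_const_mul _ hwg]; ring
  · refine hf.mul ?_
    have hm : Measurable fun p : ℝ × ℝ => gaussianPDF (h * p.1) s p.2 * g p.2 := by
      refine Measurable.mul ?_ (hg.comp measurable_snd)
      have h2 : Measurable fun p : ℝ × ℝ => (h * p.1, s, p.2) := by fun_prop
      exact measurable_uncurry_gaussianPDF.comp h2
    exact hm.lintegral_prod_right'

/-- The bound for the joint tail probability of a standard Gaussian pair of correlation `h`. -/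
def tailBound (h v : ℝ) : ℝ := pairBound h v * ((1 + |h|) / v) ^ 2

theorem tailBound_nonneg (h v : ℝ) : 0 ≤ tailBound h v :=
  mul_nonneg (pairBound_nonneg h v) (sq_nonneg _)

theorem integral_pair_le_of_lintegral {Ω : Type*} [MeasurableSpace Ω] {P : Measure Ω}
    {U V : Ω → ℝ} {h v a b : ℝ}
    (hUV : HasGaussianLaw (fun ω => (U ω, V ω)) P) (hU : HasLaw U (gaussianReal 0 1) P)
    (hV : HasLaw V (gaussianReal 0 1) P) (hh : ∫ ω, U ω * V ω ∂P = h) (hh1 : |h| < 1)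
    (hv : 0 < v) {f g : ℝ → ℝ} (hf : Continuous f) (hg : Continuous g)
    (hf0 : ∀ x, x ≤ v → f x = 0) (hg0 : ∀ x, x ≤ v → g x = 0)
    (hfn : ∀ x, 0 ≤ f x) (hgn : ∀ x, 0 ≤ g x) (ha : 0 ≤ a) (hb : 0 ≤ b)
    (hfa : ∫⁻ x, ENNReal.ofReal (expWeight h v x) * ENNReal.ofReal (f x) ≤ ENNReal.ofReal a)
    (hgb : ∫⁻ x, ENNReal.ofReal (expWeight h v x) * ENNReal.ofReal (g x) ≤ ENNReal.ofReal b) :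
    ∫ ω, f (U ω) * g (V ω) ∂P ≤ pairBound h v * a * b := by
  have hm : AEStronglyMeasurable (fun ω => f (U ω) * g (V ω)) P :=
    ((hf.measurable.comp_aemeasurable hU.aemeasurable).mul
      (hg.measurable.comp_aemeasurable hV.aemeasurable)).aestronglyMeasurable
  rw [integral_eq_lintegral_of_nonneg_ae
    (ae_of_all _ fun ω => mul_nonneg (hfn _) (hgn _)) hm]
  have hp := pairBound_nonneg h v
  refine ENNReal.toReal_le_of_le_ofReal (by positivity) ?_
  simp only [ENNReal.ofReal_mul (hfn _)]
  refine (lintegral_pair_le hUV hU hV hh hh1 hv hf.measurable.ennreal_ofReal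
    hg.measurable.ennreal_ofReal (fun x hx => by simp [hf0 x hx.le])
    (fun x hx => by simp [hg0 x hx.le])).trans ?_
  rw [ENNReal.ofReal_mul (by positivity), ENNReal.ofReal_mul hp]
  gcongr

/-- For the tail factors `1 - ψ`: these are only bounded by `1`, so the mass of the weight is used.
-/
theorem lintegral_expWeight_mul_le {h v : ℝ} (hv : 0 < v) {f : ℝ → ℝ}
    (hf0 : ∀ x, x ≤ v → f x = 0) (hf1 : ∀ x, f x ≤ 1) :
    ∫⁻ x, ENNReal.ofReal (expWeight h v x) * ENNReal.ofReal (f x)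
      ≤ ENNReal.ofReal ((1 + |h|) / v) := by
  rw [← lintegral_expWeight hv, ← lintegral_indicator measurableSet_Ioi]
  refine lintegral_mono fun x => ?_
  by_cases hx : x ≤ v
  · simp [hf0 x hx]
  · simp only [Set.indicator, Set.mem_Ioi, not_le.1 hx, if_true]
    exact mul_le_of_le_one_right' (by simpa using hf1 x)

/-- For the factors `-ψ'`: these have total mass at most `1`, so the weight is bounded by `1`. -/
theorem lintegral_expWeight_mul_le_lintegral {h v : ℝ} (hv : 0 < v) {f : ℝ → ℝ}
    (hf0 : ∀ x, x ≤ v → f x = 0) :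
    ∫⁻ x, ENNReal.ofReal (expWeight h v x) * ENNReal.ofReal (f x)
      ≤ ∫⁻ x, ENNReal.ofReal (f x) := by
  refine lintegral_mono fun x => ?_
  by_cases hx : x ≤ v
  · simp [hf0 x hx]
  · refine mul_le_of_le_one_left' ?_
    rw [ENNReal.ofReal_le_one, expWeight, Real.exp_le_one_iff, neg_nonpos]
    have : 0 ≤ x - v := by linarith [not_le.1 hx]
    positivity

/-- The bound by a square root lets two unpaired tail factors from different columns cost no more
than one paired column. The Mills-type bound `φ(v) / v` has square at most `tailBound h v` for every
admissible `h`. -/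
theorem integral_single_le {Ω : Type*} [MeasurableSpace Ω] {P : Measure Ω} {U : Ω → ℝ} {h v : ℝ}
    (hU : HasLaw U (gaussianReal 0 1) P) (hh1 : |h| < 1) (hv : 0 < v) {f : ℝ → ℝ}
    (hf : Continuous f) (hf0 : ∀ x, x ≤ v → f x = 0) (hfn : ∀ x, 0 ≤ f x) (hf1 : ∀ x, f x ≤ 1) :
    ∫ ω, f (U ω) ∂P ≤ √(tailBound h v) := by
  have hs : 0 < 1 - h ^ 2 := by
    have := sq_lt_one_iff_abs_lt_one h |>.2 hh1
    linarith
  have h0 := abs_nonneg h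
  have hle : Real.exp (-(v ^ 2 / 2)) / √(2 * Real.pi) * (1 / v) ≤ √(tailBound h v) := by
    refine Real.le_sqrt_of_sq_le ?_
    rw [tailBound, pairBound, mul_pow, div_pow, Real.sq_sqrt (by positivity), ← Real.exp_nat_mul]
    have h1 : √(1 - h ^ 2) ≤ 1 := Real.sqrt_le_one.2 (by nlinarith [sq_nonneg h])
    have h2 : 0 < √(1 - h ^ 2) := Real.sqrt_pos.2 hs
    have h3 : 2 * Real.pi * √(1 - h ^ 2) ≤ 2 * Real.pi :=
      mul_le_of_le_one_right (by positivity) h1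
    gcongr
    · have h4 : v ^ 2 / (1 + |h|) ≤ v ^ 2 := div_le_self (sq_nonneg v) (by linarith)
      push_cast
      linarith
    · linarith
  refine le_trans ?_ hle
  have hm : AEStronglyMeasurable (fun ω => f (U ω)) P :=
    (hf.measurable.comp_aemeasurable hU.aemeasurable).aestronglyMeasurable
  rw [integral_eq_lintegral_of_nonneg_ae (ae_of_all _ fun ω => hfn _) hm]
  refine ENNReal.toReal_le_of_le_ofReal (by positivity) ?_
  rw [hU.lintegral_comp (f := fun x => ENNReal.ofReal (f x))
    hf.measurable.ennreal_ofReal.aemeasurable,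
    lintegral_gaussianReal one_ne_zero hf.measurable.ennreal_ofReal]
  -- With `h = 0` the weight is `exp (-v (x - v))`, the tangent-line bound for the one-dimensional
  -- density.
  have hw := lintegral_expWeight_mul_le (h := 0) hv hf0 hf1
  simp only [abs_zero, add_zero] at hw
  rw [ENNReal.ofReal_mul (by positivity)]
  refine le_trans ?_ (mul_le_mul_right hw _)
  have hwf : Measurable fun x => ENNReal.ofReal (expWeight 0 v x) * ENNReal.ofReal (f x) :=
    (measurable_expWeight 0 v).ennreal_ofReal.mul hf.measurable.ennreal_ofReal
  rw [← lintegral_const_mul _ hwf]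
  refine lintegral_mono fun x => ?_
  simp only
  by_cases hx : x ≤ v
  · simp [hf0 x hx]
  rw [← mul_assoc]
  gcongr
  rw [gaussianPDF, ← ENNReal.ofReal_mul (by positivity)]
  refine ENNReal.ofReal_le_ofReal ?_
  have e : Real.exp (-(v ^ 2 / 2)) / √(2 * Real.pi) * expWeight 0 v x
      = (√(2 * Real.pi))⁻¹ * Real.exp (-(v ^ 2 / 2) + -(v * (x - v) / (1 + |0|))) := by
    rw [Real.exp_add, expWeight]; ring
  rw [e]
  simp only [gaussianPDFReal_def, NNReal.coe_one, mul_one, abs_zero, add_zero, div_one, sub_zero]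
  gcongr
  nlinarith [sq_nonneg (x - v)]

end Pair

/-- Decreasing cutoffs equal to `1` up to `v`. -/
structure IsTailCutoff (v : ℝ) (ψ ψ' : ℝ → ℝ) : Prop extends IsCutoff ψ ψ' where
  deriv_nonpos : ∀ x, ψ' x ≤ 0
  eq_one : ∀ x, x ≤ v → ψ x = 1
  deriv_eq_zero : ∀ x, x ≤ v → ψ' x = 0
  lintegral_le : ∫⁻ x, ENNReal.ofReal (-ψ' x) ≤ 1

/-- Cutoffs at the different levels of the rows can all be estimated at the smallest level. -/
theorem IsTailCutoff.mono {u v : ℝ} {ψ ψ' : ℝ → ℝ} (h : IsTailCutoff u ψ ψ') (hvu : v ≤ u) :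
    IsTailCutoff v ψ ψ' :=
  { h with
    eq_one := fun x hx => h.eq_one x (hx.trans hvu)
    deriv_eq_zero := fun x hx => h.deriv_eq_zero x (hx.trans hvu) }

/-! ### Factorization over independent columns -/

section Columns

variable {Ω : Type*} [MeasurableSpace Ω] {P : Measure Ω} {n : ℕ}

/-- Two rows of standard Gaussian variables with independent columns of correlation `h`. -/
structure IsGaussianRowPair (P : Measure Ω) (U V : Fin n → Ω → ℝ) (h : ℝ) : Prop where
  gaussian : HasGaussianLaw (fun ω k (b : Bool) => cond b (U k ω) (V k ω)) P
  left : ∀ k, HasLaw (U k) (gaussianReal 0 1) P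
  right : ∀ k, HasLaw (V k) (gaussianReal 0 1) P
  cross : ∀ k, ∫ ω, U k ω * V k ω ∂P = h
  indep : ∀ k k', k ≠ k' → ∀ b b' : Bool,
    ∫ ω, cond b (U k ω) (V k ω) * cond b' (U k' ω) (V k' ω) ∂P = 0

variable {U V : Fin n → Ω → ℝ} {h : ℝ}

theorem IsGaussianRowPair.hasLaw_cond (H : IsGaussianRowPair P U V h) (k : Fin n) (b : Bool) :
    HasLaw (fun ω => cond b (U k ω) (V k ω)) (gaussianReal 0 1) P := by
  cases b
  · exact H.right k
  · exact H.left k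

theorem IsGaussianRowPair.iIndepFun (H : IsGaussianRowPair P U V h) :
    iIndepFun (fun k ω (b : Bool) => cond b (U k ω) (V k ω)) P := by
  have := H.gaussian.isProbabilityMeasure
  refine HasGaussianLaw.iIndepFun_of_covariance_eval
    (X := fun k (b : Bool) ω => cond b (U k ω) (V k ω)) H.gaussian fun k k' hk b b' => ?_
  have m : ∀ k (b : Bool), MemLp (fun ω => cond b (U k ω) (V k ω)) 2 P := fun k b =>
    ((H.gaussian.eval k).eval b).memLp_two
  rw [covariance_eq_sub (m k b) (m k' b')]
  have h0 : ∫ ω, cond b (U k ω) (V k ω) ∂P = 0 := by simpa using (H.hasLaw_cond k b).integral_eq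
  simp only [Pi.mul_apply]
  rw [h0, H.indep k k' hk b b']; ring

theorem IsGaussianRowPair.pair (H : IsGaussianRowPair P U V h) (k : Fin n) :
    HasGaussianLaw (fun ω => (U k ω, V k ω)) P := by
  have := (H.gaussian.eval k).map_fun
    ((ContinuousLinearMap.proj true : (Bool → ℝ) →L[ℝ] ℝ).prod (ContinuousLinearMap.proj false))
  exact this

theorem prod_erase_ite (q : ℝ) (j : Fin n) (T : Finset (Fin n)) {r : ℕ} (hj : j ∉ T)
    (hT : T.card + 1 = r) :
    (∏ k ∈ Finset.univ.erase j, if k ∈ T then 1 else q) = q ^ (n - r) := by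
  rw [Finset.prod_ite, Finset.prod_const_one, one_mul, Finset.prod_const]
  congr 1
  have e : (Finset.univ.erase j).filter (fun k => k ∉ T) = (insert j T)ᶜ := by
    ext k; simp [and_comm]
  rw [e, Finset.card_compl, Finset.card_insert_of_notMem hj, hT, Fintype.card_fin]

variable {v : ℝ} {ψ ψ' χ χ' : ℝ → ℝ}

/-- The propositions `p`, `p'` stand for `k ∈ T`, `k ∈ T'`. Each tail factor present is charged one
square root of `tailBound`, whether or not the other row has one in the same column. -/
theorem IsGaussianRowPair.integral_cutoff_le (H : IsGaussianRowPair P U V h) (hh : |h| < 1)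
    (hv : 0 < v) (hψ : IsTailCutoff v ψ ψ') (hχ : IsTailCutoff v χ χ') (k : Fin n)
    (p p' : Prop) [Decidable p] [Decidable p'] :
    ∫ ω, (if p then 1 else 1 - ψ (U k ω)) * (if p' then 1 else 1 - χ (V k ω)) ∂P
      ≤ (if p then 1 else √(tailBound h v)) * (if p' then 1 else √(tailBound h v)) := by
  have := H.gaussian.isProbabilityMeasure
  have c1 : Continuous fun x => 1 - ψ x := continuous_const.sub hψ.continuous
  have c2 : Continuous fun x => 1 - χ x := continuous_const.sub hχ.continuous
  have z1 : ∀ x, x ≤ v → 1 - ψ x = 0 := fun x hx => by rw [hψ.eq_one x hx, sub_self]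
  have z2 : ∀ x, x ≤ v → 1 - χ x = 0 := fun x hx => by rw [hχ.eq_one x hx, sub_self]
  have n1 : ∀ x, 0 ≤ 1 - ψ x := fun x => sub_nonneg.2 (hψ.mem x).2
  have n2 : ∀ x, 0 ≤ 1 - χ x := fun x => sub_nonneg.2 (hχ.mem x).2
  have l1 : ∀ x, 1 - ψ x ≤ 1 := fun x => sub_le_self _ (hψ.mem x).1
  have l2 : ∀ x, 1 - χ x ≤ 1 := fun x => sub_le_self _ (hχ.mem x).1
  by_cases hp : p <;> by_cases hp' : p'
  · simp [hp, hp']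
  · simpa [hp, hp'] using integral_single_le (H.right k) hh hv c2 z2 n2 l2
  · simpa [hp, hp'] using integral_single_le (H.left k) hh hv c1 z1 n1 l1
  · simp only [hp, hp', if_false]
    rw [Real.mul_self_sqrt (tailBound_nonneg h v), tailBound, sq, ← mul_assoc]
    have hg : 0 ≤ (1 + |h|) / v := by positivity
    exact integral_pair_le_of_lintegral (H.pair k) (H.left k) (H.right k) (H.cross k) hh hv c1 c2
      z1 z2 n1 n2 hg hg (lintegral_expWeight_mul_le hv z1 l1) (lintegral_expWeight_mul_le hv z2 l2)

theorem IsGaussianRowPair.integral_deriv_le (H : IsGaussianRowPair P U V h) (hh : |h| < 1)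
    (hv : 0 < v) (hψ : IsTailCutoff v ψ ψ') (hχ : IsTailCutoff v χ χ') (k : Fin n) :
    ∫ ω, ψ' (U k ω) * χ' (V k ω) ∂P ≤ pairBound h v := by
  have z1 : ∀ x, x ≤ v → -ψ' x = 0 := fun x hx => by rw [hψ.deriv_eq_zero x hx, neg_zero]
  have z2 : ∀ x, x ≤ v → -χ' x = 0 := fun x hx => by rw [hχ.deriv_eq_zero x hx, neg_zero]
  have := integral_pair_le_of_lintegral (f := fun x => -ψ' x) (g := fun x => -χ' x)
    (H.pair k) (H.left k) (H.right k) (H.cross k) hh hv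
    hψ.continuous_deriv.neg hχ.continuous_deriv.neg z1 z2
    (fun x => neg_nonneg.2 (hψ.deriv_nonpos x)) (fun x => neg_nonneg.2 (hχ.deriv_nonpos x))
    zero_le_one zero_le_one
    ((lintegral_expWeight_mul_le_lintegral hv z1).trans (by simpa using hψ.lintegral_le))
    ((lintegral_expWeight_mul_le_lintegral hv z2).trans (by simpa using hχ.lintegral_le))
  simpa using this

/-- The product of the factors of all columns. -/
def columnFactor (ψ ψ' χ χ' : ℝ → ℝ) (j : Fin n) (T T' : Finset (Fin n)) (k : Fin n)
    (x y : ℝ) : ℝ :=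
  if k = j then ψ' x * χ' y
  else (if k ∈ T then 1 else 1 - ψ x) * (if k ∈ T' then 1 else 1 - χ y)

theorem continuous_columnFactor (hψ : IsTailCutoff v ψ ψ') (hχ : IsTailCutoff v χ χ') (j : Fin n)
    (T T' : Finset (Fin n)) (k : Fin n) :
    Continuous fun z : ℝ × ℝ => columnFactor ψ ψ' χ χ' j T T' k z.1 z.2 := by
  have c1 := hψ.continuous
  have c2 := hχ.continuous
  have c3 := hψ.continuous_deriv
  have c4 := hχ.continuous_deriv
  unfold columnFactor
  split_ifs <;> fun_prop

theorem columnFactor_nonneg (hψ : IsTailCutoff v ψ ψ') (hχ : IsTailCutoff v χ χ') (j : Fin n)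
    (T T' : Finset (Fin n)) (k : Fin n) (x y : ℝ) : 0 ≤ columnFactor ψ ψ' χ χ' j T T' k x y := by
  have n1 : 0 ≤ 1 - ψ x := sub_nonneg.2 (hψ.mem x).2
  have n2 : 0 ≤ 1 - χ y := sub_nonneg.2 (hχ.mem y).2
  unfold columnFactor
  split_ifs
  · exact mul_nonneg_of_nonpos_of_nonpos (hψ.deriv_nonpos x) (hχ.deriv_nonpos y)
  all_goals positivity

theorem prod_columnFactor (ψ ψ' χ χ' : ℝ → ℝ) (j : Fin n) (T T' : Finset (Fin n))
    (x y : Fin n → ℝ) :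
    ∏ k, columnFactor ψ ψ' χ χ' j T T' k (x k) (y k) = ψ' (x j) * χ' (y j) *
      ((∏ k ∈ Finset.univ.erase j, if k ∈ T then 1 else 1 - ψ (x k)) *
      ∏ k ∈ Finset.univ.erase j, if k ∈ T' then 1 else 1 - χ (y k)) := by
  rw [← Finset.mul_prod_erase _ _ (Finset.mem_univ j), ← Finset.prod_mul_distrib]
  congr 1
  · simp [columnFactor]
  · refine Finset.prod_congr rfl fun k hk => ?_
    simp [columnFactor, Finset.ne_of_mem_erase hk]

theorem IsGaussianRowPair.integral_prod_columnFactor_le (H : IsGaussianRowPair P U V h)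
    (hh : |h| < 1) (hv : 0 < v) (hψ : IsTailCutoff v ψ ψ') (hχ : IsTailCutoff v χ χ') (j : Fin n)
    {r : ℕ} {T T' : Finset (Fin n)} (hT : j ∉ T ∧ T.card + 1 = r) (hT' : j ∉ T' ∧ T'.card + 1 = r) :
    ∫ ω, ∏ k, columnFactor ψ ψ' χ χ' j T T' k (U k ω) (V k ω) ∂P
      ≤ pairBound h v * tailBound h v ^ (n - r) := by
  have hmeas : ∀ k, Continuous fun z : Bool → ℝ =>
      columnFactor ψ ψ' χ χ' j T T' k (z true) (z false) := fun k =>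
    (continuous_columnFactor hψ hχ j T T' k).comp
      (by fun_prop : Continuous fun z : Bool → ℝ => (z true, z false))
  have key := H.iIndepFun.integral_fun_prod_comp
    (f := fun k (z : Bool → ℝ) => columnFactor ψ ψ' χ χ' j T T' k (z true) (z false))
    (fun k => (H.gaussian.eval k).aemeasurable) (fun k => (hmeas k).aestronglyMeasurable)
  simp only [cond_true, cond_false] at key
  rw [key, ← Finset.mul_prod_erase _ _ (Finset.mem_univ j)]
  -- Each row contributes `n - r` square roots, so the total does not depend on how `T` and `T'`
  -- overlap.
  have hq : tailBound h v ^ (n - r) =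
      ∏ k ∈ Finset.univ.erase j, ((if k ∈ T then 1 else √(tailBound h v)) *
        (if k ∈ T' then 1 else √(tailBound h v))) := by
    rw [Finset.prod_mul_distrib, prod_erase_ite _ j T hT.1 hT.2, prod_erase_ite _ j T' hT'.1 hT'.2,
      ← mul_pow, Real.mul_self_sqrt (tailBound_nonneg h v)]
  rw [hq]
  refine mul_le_mul ?_ (Finset.prod_le_prod (fun k _ => integral_nonneg fun ω =>
    columnFactor_nonneg hψ hχ j T T' k _ _) fun k hk => ?_) (Finset.prod_nonneg fun k _ =>
    integral_nonneg fun ω => columnFactor_nonneg hψ hχ j T T' k _ _) (pairBound_nonneg h v)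
  · simpa [columnFactor] using H.integral_deriv_le hh hv hψ hχ j
  · simpa [columnFactor, Finset.ne_of_mem_erase hk] using
      H.integral_cutoff_le hh hv hψ hχ k (k ∈ T) (k ∈ T')

theorem integrable_prod_columnFactor [IsFiniteMeasure P] (hU : ∀ k, AEMeasurable (U k) P)
    (hV : ∀ k, AEMeasurable (V k) P)
    (hψ : IsTailCutoff v ψ ψ') (hχ : IsTailCutoff v χ χ') (j : Fin n) (T T' : Finset (Fin n)) :
    Integrable (fun ω => ∏ k, columnFactor ψ ψ' χ χ' j T T' k (U k ω) (V k ω)) P := by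
  obtain ⟨C, hC0, hC⟩ := hψ.bound
  obtain ⟨D, hD0, hD⟩ := hχ.bound
  refine Integrable.of_bound (C := C * D) ?_ (ae_of_all _ fun ω => ?_)
  · refine AEMeasurable.aestronglyMeasurable (Finset.aemeasurable_fun_prod _ fun k _ => ?_)
    exact (continuous_columnFactor hψ hχ j T T' k).measurable.comp_aemeasurable
      ((hU k).prodMk (hV k))
  · rw [prod_columnFactor, Real.norm_eq_abs, abs_mul, abs_mul, abs_mul]
    have hb : ∀ (ξ ξ' : ℝ → ℝ), IsTailCutoff v ξ ξ' → ∀ (S : Finset (Fin n)) (x : Fin n → ℝ),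
        |∏ k ∈ Finset.univ.erase j, if k ∈ S then 1 else 1 - ξ (x k)| ≤ 1 := by
      intro ξ ξ' hξ S x
      have h0 : ∀ k, 0 ≤ if k ∈ S then 1 else 1 - ξ (x k) := fun k => by
        split_ifs
        · exact zero_le_one
        · exact sub_nonneg.2 (hξ.mem _).2
      rw [abs_of_nonneg (Finset.prod_nonneg fun k _ => h0 k)]
      refine Finset.prod_le_one (fun k _ => h0 k) fun k _ => ?_
      split_ifs
      · exact le_rfl
      · exact sub_le_self _ (hξ.mem _).1
    calc _ ≤ (C * D) * (1 * 1) := by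
          gcongr
          · exact hC _
          · exact hD _
          · exact hb ψ ψ' hψ T _
          · exact hb χ χ' hχ T' _
      _ = C * D := by ring

/-- The bound for the second-order slopes of the counting polynomial of two rows. -/
theorem IsGaussianRowPair.integral_slopeAt_le (H : IsGaussianRowPair P U V h)
    (hh : |h| < 1) (hv : 0 < v) (hψ : IsTailCutoff v ψ ψ') (hχ : IsTailCutoff v χ χ') (j : Fin n)
    {r : ℕ} (hr : 1 ≤ r) {f : Ω → ℝ} (hf0 : ∀ ω, 0 ≤ f ω)
    (hf : ∀ ω, f ω ≤ ψ' (U j ω) * χ' (V j ω) * (slopeAt (countPoly r) j (fun k => ψ (U k ω)) *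
      slopeAt (countPoly r) j (fun k => χ (V k ω)))) :
    ∫ ω, f ω ∂P ≤ ((n - 1).choose (r - 1) : ℝ) ^ 2 *
      (pairBound h v * tailBound h v ^ (n - r)) := by
  have := H.gaussian.isProbabilityMeasure
  have hi : ∀ T T', Integrable
      (fun ω => ∏ k, columnFactor ψ ψ' χ χ' j T T' k (U k ω) (V k ω)) P :=
    integrable_prod_columnFactor (fun k => (H.left k).aemeasurable)
      (fun k => (H.right k).aemeasurable) hψ hχ j
  -- Expanding the two slopes gives one product for each pair `(T, T')`, whence the squared binomial
  -- coefficient.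
  set 𝒯 := Finset.univ.filter fun T : Finset (Fin n) => j ∉ T ∧ T.card + 1 = r with h𝒯
  have hcard : 𝒯.card = (n - 1).choose (r - 1) := by
    rw [h𝒯, card_filter_notMem r hr j, Fintype.card_fin]
  calc ∫ ω, f ω ∂P
      ≤ ∫ ω, ∑ T ∈ 𝒯, ∑ T' ∈ 𝒯, ∏ k, columnFactor ψ ψ' χ χ' j T T' k (U k ω) (V k ω) ∂P := by
        refine integral_mono_of_nonneg (ae_of_all _ hf0)
          (integrable_finsetSum _ fun T _ => integrable_finsetSum _ fun T' _ => hi T T')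
          (ae_of_all _ fun ω => (hf ω).trans ?_)
        simp only [prod_columnFactor]
        simp only [← Finset.mul_sum, ← Finset.sum_mul]
        have hp : 0 ≤ ψ' (U j ω) * χ' (V j ω) :=
          mul_nonneg_of_nonpos_of_nonpos (hψ.deriv_nonpos _) (hχ.deriv_nonpos _)
        refine mul_le_mul_of_nonneg_left ?_ hp
        exact mul_le_mul (slopeAt_countPoly_le (fun k => hψ.mem _) r j)
          (slopeAt_countPoly_le (fun k => hχ.mem _) r j)
          (slopeAt_countPoly_nonneg (fun k => hχ.mem _) r j)
          ((slopeAt_countPoly_nonneg (fun k => hψ.mem _) r j).trans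
            (slopeAt_countPoly_le (fun k => hψ.mem _) r j))
    _ = ∑ T ∈ 𝒯, ∑ T' ∈ 𝒯, ∫ ω, ∏ k, columnFactor ψ ψ' χ χ' j T T' k (U k ω) (V k ω) ∂P := by
        rw [integral_finsetSum _ fun T _ => integrable_finsetSum _ fun T' _ => hi T T']
        exact Finset.sum_congr rfl fun T _ => integral_finsetSum _ fun T' _ => hi T T'
    _ ≤ ∑ T ∈ 𝒯, ∑ T' ∈ 𝒯, pairBound h v * tailBound h v ^ (n - r) := by
        refine Finset.sum_le_sum fun T hT => Finset.sum_le_sum fun T' hT' => ?_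
        exact H.integral_prod_columnFactor_le hh hv hψ hχ j (Finset.mem_filter.1 hT).2
          (Finset.mem_filter.1 hT').2
    _ = _ := by
        simp only [Finset.sum_const, nsmul_eq_mul, hcard]; ring

end Columns

/-! ### Smooth cutoffs converging to indicators -/

section SmoothCutoff

/-- A smooth decreasing function equal to `1` up to `u` and to `0` from `u + 1 / (m + 1)` on. -/
def smoothCutoff (m : ℕ) (u x : ℝ) : ℝ := 1 - Real.smoothTransition ((m + 1) * (x - u))

theorem contDiff_smoothCutoff (m : ℕ) (u : ℝ) : ContDiff ℝ 1 (smoothCutoff m u) := by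
  unfold smoothCutoff
  exact contDiff_const.sub ((Real.smoothTransition.contDiff (n := 1)).comp (by fun_prop))

theorem smoothCutoff_mem (m : ℕ) (u x : ℝ) : smoothCutoff m u x ∈ Set.Icc (0 : ℝ) 1 :=
  ⟨sub_nonneg.2 (Real.smoothTransition.le_one _), sub_le_self _ (Real.smoothTransition.nonneg _)⟩

theorem smoothCutoff_of_le (m : ℕ) {u x : ℝ} (h : x ≤ u) : smoothCutoff m u x = 1 := by
  rw [smoothCutoff, Real.smoothTransition.zero_of_nonpos, sub_zero]
  exact mul_nonpos_of_nonneg_of_nonpos (by positivity) (by linarith)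

theorem smoothCutoff_of_one_le {m : ℕ} {u x : ℝ} (h : 1 ≤ (m + 1) * (x - u)) :
    smoothCutoff m u x = 0 := by
  rw [smoothCutoff, Real.smoothTransition.one_of_one_le h, sub_self]

theorem antitone_smoothCutoff (m : ℕ) (u : ℝ) : Antitone (smoothCutoff m u) := by
  intro x y hxy
  unfold smoothCutoff
  have : ((m : ℝ) + 1) * (x - u) ≤ (m + 1) * (y - u) :=
    mul_le_mul_of_nonneg_left (by linarith) (by positivity)
  linarith [Real.smoothTransition.monotone this]

/-- The cutoff attains its maximum `1` there, which also covers the endpoint `x = u`. -/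
theorem deriv_smoothCutoff_of_le (m : ℕ) {u x : ℝ} (h : x ≤ u) :
    deriv (smoothCutoff m u) x = 0 := by
  refine IsLocalMax.deriv_eq_zero (Filter.Eventually.of_forall fun y => ?_)
  rw [smoothCutoff_of_le m h]
  exact (smoothCutoff_mem m u y).2

theorem deriv_smoothCutoff_of_one_le {m : ℕ} {u x : ℝ} (h : 1 ≤ (m + 1) * (x - u)) :
    deriv (smoothCutoff m u) x = 0 := by
  refine IsLocalMin.deriv_eq_zero (Filter.Eventually.of_forall fun y => ?_)
  rw [smoothCutoff_of_one_le h]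
  exact (smoothCutoff_mem m u y).1

theorem one_le_of_add_one_le (m : ℕ) {u x : ℝ} (h : u + 1 ≤ x) :
    1 ≤ ((m : ℝ) + 1) * (x - u) := by
  have : (0 : ℝ) ≤ m := by positivity
  nlinarith

/-- For every `m` the derivative vanishes outside `(u, u + 1]`, and the mass of its negative is the
total drop of the cutoff from `1` to `0`. -/
theorem isTailCutoff_smoothCutoff (m : ℕ) (u : ℝ) :
    IsTailCutoff u (smoothCutoff m u) (deriv (smoothCutoff m u)) := by
  have hd : ∀ x, HasDerivAt (smoothCutoff m u) (deriv (smoothCutoff m u) x) x := fun x =>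
    ((contDiff_smoothCutoff m u).differentiable one_ne_zero x).hasDerivAt
  have hc : Continuous (deriv (smoothCutoff m u)) :=
    (contDiff_smoothCutoff m u).continuous_deriv le_rfl
  have hout : ∀ x, x ∉ Set.Ioc u (u + 1) → deriv (smoothCutoff m u) x = 0 := by
    intro x hx
    rw [Set.mem_Ioc, not_and_or, not_lt, not_le] at hx
    rcases hx with hx | hx
    · exact deriv_smoothCutoff_of_le m hx
    · exact deriv_smoothCutoff_of_one_le (one_le_of_add_one_le m hx.le)
  have hnp : ∀ x, deriv (smoothCutoff m u) x ≤ 0 := fun x =>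
    (antitone_smoothCutoff m u).deriv_nonpos
  refine { hasDerivAt := hd, continuous_deriv := hc, bound := ?_, mem := smoothCutoff_mem m u,
           deriv_nonpos := hnp, eq_one := fun x => smoothCutoff_of_le m,
           deriv_eq_zero := fun x => deriv_smoothCutoff_of_le m, lintegral_le := ?_ }
  · obtain ⟨C, hC⟩ := (isCompact_Icc (a := u) (b := u + 1)).exists_bound_of_continuousOn
      hc.continuousOn
    refine ⟨|C|, abs_nonneg _, fun x => ?_⟩
    by_cases hx : x ∈ Set.Ioc u (u + 1)
    · exact (hC x (Set.Ioc_subset_Icc_self hx)).trans (le_abs_self C)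
    · rw [hout x hx, abs_zero]; exact abs_nonneg _
  · have e : ∫⁻ x, ENNReal.ofReal (-deriv (smoothCutoff m u) x)
        = ∫⁻ x in Set.Ioc u (u + 1), ENNReal.ofReal (-deriv (smoothCutoff m u) x) := by
      rw [← lintegral_indicator measurableSet_Ioc]
      refine lintegral_congr fun x => ?_
      by_cases hx : x ∈ Set.Ioc u (u + 1)
      · rw [Set.indicator_of_mem hx]
      · rw [Set.indicator_of_notMem hx, hout x hx]; simp
    have hi : IntegrableOn (fun x => -deriv (smoothCutoff m u) x) (Set.Ioc u (u + 1)) :=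
      hc.neg.integrableOn_Ioc
    rw [e, ← ofReal_integral_eq_lintegral_ofReal hi
      (ae_of_all _ fun x => neg_nonneg.2 (hnp x)),
      ← intervalIntegral.integral_of_le (by linarith), intervalIntegral.integral_neg,
      intervalIntegral.integral_eq_sub_of_hasDerivAt (fun x _ => hd x) (hc.intervalIntegrable _ _),
      smoothCutoff_of_le m le_rfl, smoothCutoff_of_one_le (one_le_of_add_one_le m le_rfl)]
    simp

theorem eventually_smoothCutoff_eq (u x : ℝ) :
    ∀ᶠ m : ℕ in Filter.atTop, smoothCutoff m u x = if x ≤ u then 1 else 0 := by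
  by_cases h : x ≤ u
  · simp [h, smoothCutoff_of_le]
  · have hpos : 0 < x - u := by linarith
    obtain ⟨N, hN⟩ := exists_nat_gt (1 / (x - u))
    filter_upwards [Filter.eventually_ge_atTop N] with m hm
    rw [if_neg h, smoothCutoff_of_one_le]
    rw [div_lt_iff₀ hpos] at hN
    have : (N : ℝ) ≤ m := by exact_mod_cast hm
    nlinarith

end SmoothCutoff

/-! ### The interpolation formula for arrays with independent columns -/

section Arrays

variable {d n : ℕ} {μ₁ μ₀ : Measure (Fin d × Fin n → ℝ)} {σ₁ σ₀ : Fin d → Fin d → ℝ}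

/-- The second moments of an array with independent columns. -/
def columnMoment (σ : Fin d → Fin d → ℝ) (a b : Fin d × Fin n) : ℝ :=
  if a.2 = b.2 then σ a.1 b.1 else 0

theorem isGaussianRowPair_interp (h₁ : IsStdGaussian μ₁ (columnMoment σ₁))
    (h₀ : IsStdGaussian μ₀ (columnMoment σ₀)) (θ : ℝ) (i l : Fin d) :
    IsGaussianRowPair (μ₁.prod μ₀) (fun k w => interp θ w (i, k)) (fun k w => interp θ w (l, k))
      (Real.sin θ ^ 2 * σ₁ i l + Real.cos θ ^ 2 * σ₀ i l) where
  gaussian := by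
    have := (hasGaussianLaw_interp h₁ h₀ θ).map_fun (ContinuousLinearMap.pi fun k : Fin n =>
      ContinuousLinearMap.pi fun b : Bool => ContinuousLinearMap.proj (cond b i l, k))
    convert! this using 2 with w
    ext k b
    cases b <;> rfl
  left k := hasLaw_interp h₁ h₀ θ (i, k)
  right k := hasLaw_interp h₁ h₀ θ (l, k)
  cross k := by
    rw [integral_interp_mul_interp h₁ h₀]
    simp [columnMoment]
  indep k k' hk b b' := by
    cases b <;> cases b' <;> simp [integral_interp_mul_interp h₁ h₀, columnMoment, hk]

/-- The second-order term of the interpolation formula. -/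
def mixedTerm (μ₁ μ₀ : Measure (Fin d × Fin n → ℝ)) (r m : ℕ) (u : Fin d → ℝ) (θ : ℝ)
    (a b : Fin d × Fin n) : ℝ :=
  ∫ w, deriv (smoothCutoff m (u a.1)) (interp θ w a) * deriv (smoothCutoff m (u b.1)) (interp θ w b)
    * slopeAt (slopeAt (rowPoly r) a) b (fun c => smoothCutoff m (u c.1) (interp θ w c))
    ∂(μ₁.prod μ₀)

theorem integrand_mem (r m : ℕ) (u : Fin d → ℝ) {i l : Fin d} (hil : i ≠ l) (j : Fin n)
    (z : Fin d × Fin n → ℝ) :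
    deriv (smoothCutoff m (u i)) (z (i, j)) * deriv (smoothCutoff m (u l)) (z (l, j))
    * slopeAt (slopeAt (rowPoly r) (i, j)) (l, j) (fun c => smoothCutoff m (u c.1) (z c)) ∈
    Set.Icc 0 (deriv (smoothCutoff m (u i)) (z (i, j)) * deriv (smoothCutoff m (u l)) (z (l, j)) *
      (slopeAt (countPoly r) j (fun k => smoothCutoff m (u i) (z (i, k))) *
        slopeAt (countPoly r) j (fun k => smoothCutoff m (u l) (z (l, k))))) := by
  have hp : 0 ≤ deriv (smoothCutoff m (u i)) (z (i, j)) *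
      deriv (smoothCutoff m (u l)) (z (l, j)) :=
    mul_nonneg_of_nonpos_of_nonpos ((isTailCutoff_smoothCutoff m _).deriv_nonpos _)
      ((isTailCutoff_smoothCutoff m _).deriv_nonpos _)
  have := slopeAt_slopeAt_rowPoly_mem r (y := fun c => smoothCutoff m (u c.1) (z c))
    (fun c => smoothCutoff_mem m _ _) hil j j
  exact ⟨mul_nonneg hp this.1, mul_le_mul_of_nonneg_left this.2 hp⟩

/-- Two nonpositive cutoff derivatives multiply a nonnegative slope. This sign is what produces
positive parts in the comparison. -/
theorem mixedTerm_nonneg (r m : ℕ) (u : Fin d → ℝ) (θ : ℝ) {i l : Fin d} (hil : i ≠ l)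
    (j : Fin n) : 0 ≤ mixedTerm μ₁ μ₀ r m u θ (i, j) (l, j) :=
  integral_nonneg fun w => (integrand_mem r m u hil j (interp θ w)).1

theorem mixedTerm_le (h₁ : IsStdGaussian μ₁ (columnMoment σ₁))
    (h₀ : IsStdGaussian μ₀ (columnMoment σ₀)) {r : ℕ} (hr : 1 ≤ r) (m : ℕ) {u : Fin d → ℝ} {v : ℝ}
    (hv : 0 < v) (hvu : ∀ i, v ≤ u i) (θ : ℝ) {i l : Fin d} (hil : i ≠ l) (j : Fin n)
    (hh : |Real.sin θ ^ 2 * σ₁ i l + Real.cos θ ^ 2 * σ₀ i l| < 1) :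
    mixedTerm μ₁ μ₀ r m u θ (i, j) (l, j) ≤ ((n - 1).choose (r - 1) : ℝ) ^ 2 *
      (pairBound (Real.sin θ ^ 2 * σ₁ i l + Real.cos θ ^ 2 * σ₀ i l) v *
        tailBound (Real.sin θ ^ 2 * σ₁ i l + Real.cos θ ^ 2 * σ₀ i l) v ^ (n - r)) :=
  (isGaussianRowPair_interp h₁ h₀ θ i l).integral_slopeAt_le hh hv
    ((isTailCutoff_smoothCutoff m (u i)).mono (hvu i))
    ((isTailCutoff_smoothCutoff m (u l)).mono (hvu l)) j hr
    (fun w => (integrand_mem r m u hil j (interp θ w)).1)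
    (fun w => (integrand_mem r m u hil j (interp θ w)).2)

theorem symm_of_isStdGaussian [NeZero n] (h : IsStdGaussian μ₁ (columnMoment σ₁)) (i l : Fin d) :
    σ₁ i l = σ₁ l i := by
  have h1 := h.moment (i, 0) (l, 0)
  have h2 := h.moment (l, 0) (i, 0)
  simp only [columnMoment, if_true] at h1 h2
  rw [← h1, ← h2]
  simp only [mul_comm]

theorem diag_of_isStdGaussian [NeZero n] (h : IsStdGaussian μ₁ (columnMoment σ₁)) (i : Fin d) :
    σ₁ i i = 1 := by
  simpa [columnMoment] using h.diag (i, 0)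

/-- From `|x y| ≤ (x² + y²) / 2` and unit variances. -/
theorem abs_le_one_of_isStdGaussian [NeZero n] (h : IsStdGaussian μ₁ (columnMoment σ₁))
    (i l : Fin d) : |σ₁ i l| ≤ 1 := by
  have m := h.moment (i, 0) (l, 0)
  have mi := h.moment (i, 0) (i, 0)
  have ml := h.moment (l, 0) (l, 0)
  simp only [columnMoment, if_true, diag_of_isStdGaussian h] at m mi ml
  rw [← m, ← Real.norm_eq_abs]
  have ii := (h.memLp (i, 0)).integrable_mul (h.memLp (i, 0))
  have il := (h.memLp (l, 0)).integrable_mul (h.memLp (l, 0))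
  calc ‖∫ x, x (i, 0) * x (l, 0) ∂μ₁‖ ≤ ∫ x, ‖x (i, 0) * x (l, 0)‖ ∂μ₁ :=
        norm_integral_le_integral_norm _
    _ ≤ ∫ x, (1 / 2) * (x (i, 0) * x (i, 0) + x (l, 0) * x (l, 0)) ∂μ₁ := by
        refine integral_mono_of_nonneg (ae_of_all _ fun x => norm_nonneg _)
          ((ii.add il).const_mul _) (ae_of_all _ fun x => ?_)
        simp only [Real.norm_eq_abs]
        rw [abs_le]
        constructor <;> nlinarith [sq_nonneg (x (i, 0) - x (l, 0)), sq_nonneg (x (i, 0) + x (l, 0))]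
    _ = 1 := by
        rw [integral_const_mul, integral_add (by exact ii) (by exact il), mi, ml]; norm_num

/-- The integrand of the interpolation formula is bounded in terms of pairs of rows. -/
theorem sum_mixedTerm_le [NeZero n] (h₁ : IsStdGaussian μ₁ (columnMoment σ₁))
    (h₀ : IsStdGaussian μ₀ (columnMoment σ₀)) {r : ℕ} (hr : 1 ≤ r) (m : ℕ) {u : Fin d → ℝ} {v : ℝ}
    (hv : 0 < v) (hvu : ∀ i, v ≤ u i) {θ : ℝ} (hθ : θ ∈ Set.Ioo 0 (Real.pi / 2)) :
    ∑ a, ∑ b, Real.sin θ * Real.cos θ *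
        (columnMoment σ₁ a b - columnMoment (n := n) σ₀ a b) * mixedTerm μ₁ μ₀ r m u θ a b
      ≤ ∑ i, ∑ l ∈ Finset.Ioi i, 2 * (Real.sin θ * Real.cos θ) * max (σ₁ i l - σ₀ i l) 0 *
        (n * ((n - 1).choose (r - 1) : ℝ) ^ 2 *
          (pairBound (Real.sin θ ^ 2 * σ₁ i l + Real.cos θ ^ 2 * σ₀ i l) v *
          tailBound (Real.sin θ ^ 2 * σ₁ i l + Real.cos θ ^ 2 * σ₀ i l) v ^ (n - r))) := by
  have hs : 0 < Real.sin θ := Real.sin_pos_of_pos_of_lt_pi hθ.1 (by linarith [hθ.2, Real.pi_pos])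
  have hc : 0 < Real.cos θ := Real.cos_pos_of_mem_Ioo ⟨by linarith [hθ.1, Real.pi_pos], hθ.2⟩
  have hsc : Real.sin θ ^ 2 + Real.cos θ ^ 2 = 1 := Real.sin_sq_add_cos_sq θ
  set c : Fin d → Fin d → ℝ := fun i l => Real.sin θ ^ 2 * σ₁ i l + Real.cos θ ^ 2 * σ₀ i l with hcdef
  set B : Fin d → Fin d → ℝ := fun i l => Real.sin θ * Real.cos θ * max (σ₁ i l - σ₀ i l) 0 *
    (n * ((n - 1).choose (r - 1) : ℝ) ^ 2 * (pairBound (c i l) v * tailBound (c i l) v ^ (n - r)))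
    with hB
  have hBs : ∀ i l, B i l = B l i := fun i l => by
    simp only [hB, hcdef, symm_of_isStdGaussian h₁ i l, symm_of_isStdGaussian h₀ i l]
  have hpt : ∀ i l, ∀ j : Fin n, i ≠ l → Real.sin θ * Real.cos θ * (σ₁ i l - σ₀ i l) *
      mixedTerm μ₁ μ₀ r m u θ (i, j) (l, j) ≤ Real.sin θ * Real.cos θ * max (σ₁ i l - σ₀ i l) 0 *
      (((n - 1).choose (r - 1) : ℝ) ^ 2 *
        (pairBound (c i l) v * tailBound (c i l) v ^ (n - r))) := by
    intro i l j hil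
    have hD := mixedTerm_nonneg (μ₁ := μ₁) (μ₀ := μ₀) r m u θ hil j
    rcases le_or_gt (σ₁ i l) (σ₀ i l) with hle | hlt
    · rw [max_eq_right (by linarith), mul_zero, zero_mul]
      exact mul_nonpos_of_nonpos_of_nonneg
        (mul_nonpos_of_nonneg_of_nonpos (by positivity) (by linarith)) hD
    · have a1 := abs_le.1 (abs_le_one_of_isStdGaussian h₁ i l)
      have a0 := abs_le.1 (abs_le_one_of_isStdGaussian h₀ i l)
      -- A convex combination with positive weights of two distinct points of `[-1, 1]` is interior,
      -- even if an endpoint is `±1`.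
      have hh : |c i l| < 1 := by
        have hs2 : 0 < Real.sin θ ^ 2 := by positivity
        have hc2 : 0 < Real.cos θ ^ 2 := by positivity
        rw [abs_lt]
        simp only [hcdef]
        constructor <;> nlinarith
      rw [max_eq_left (by linarith)]
      refine mul_le_mul_of_nonneg_left (mixedTerm_le h₁ h₀ hr m hv hvu θ hil j hh) ?_
      exact mul_nonneg (by positivity) (by linarith)
  have hrow : ∀ i l, i ≠ l → ∑ j : Fin n, Real.sin θ * Real.cos θ * (σ₁ i l - σ₀ i l) *
      mixedTerm μ₁ μ₀ r m u θ (i, j) (l, j) ≤ B i l := by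
    intro i l hil
    refine (Finset.sum_le_sum fun j _ => hpt i l j hil).trans (le_of_eq ?_)
    rw [Finset.sum_const, Finset.card_univ, Fintype.card_fin, nsmul_eq_mul]
    simp only [hB]; ring
  -- Entries in different columns have moment `0` in both arrays, and within a row and column both
  -- moments are `1`; only one column and two different rows remain.
  have hexp : ∑ a, ∑ b, Real.sin θ * Real.cos θ *
        (columnMoment σ₁ a b - columnMoment (n := n) σ₀ a b) * mixedTerm μ₁ μ₀ r m u θ a b
      = ∑ i, ∑ l ∈ {i}ᶜ, ∑ j : Fin n, Real.sin θ * Real.cos θ * (σ₁ i l - σ₀ i l) *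
        mixedTerm μ₁ μ₀ r m u θ (i, j) (l, j) := by
    rw [Fintype.sum_prod_type]
    refine Finset.sum_congr rfl fun i _ => ?_
    rw [Finset.sum_comm' (t' := Finset.univ) (s' := fun _ => ({i} : Finset (Fin d))ᶜ)
      (by simp)]
    refine Finset.sum_congr rfl fun j _ => ?_
    rw [Fintype.sum_prod_type, ← Finset.sum_add_sum_compl ({i} : Finset (Fin d))]
    have hz : ∑ l ∈ ({i} : Finset (Fin d)), ∑ k : Fin n, Real.sin θ * Real.cos θ *
        (columnMoment σ₁ (i, j) (l, k) - columnMoment (n := n) σ₀ (i, j) (l, k)) *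
          mixedTerm μ₁ μ₀ r m u θ (i, j) (l, k) = 0 := by
      rw [Finset.sum_singleton]
      refine Finset.sum_eq_zero fun k _ => ?_
      simp [columnMoment, diag_of_isStdGaussian h₁, diag_of_isStdGaussian h₀]
    rw [hz, zero_add]
    refine Finset.sum_congr rfl fun l _ => ?_
    rw [Finset.sum_eq_single j]
    · simp [columnMoment]
    · intro k _ hk
      simp [columnMoment, hk.symm]
    · simp
  rw [hexp]
  calc _ ≤ ∑ i, ∑ l ∈ {i}ᶜ, B i l := Finset.sum_le_sum fun i _ => Finset.sum_le_sum fun l hl =>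
        hrow i l (by simpa [eq_comm] using hl)
    _ = ∑ i, ∑ l ∈ {i}ᶜ, B l i := by simp only [fun i l => hBs i l]
    -- The two orders of a pair contribute equally; the resulting factor `2` completes `2 sin θ cos
    -- θ`, the derivative of `sin² θ`.
    _ = ∑ i, ∑ l ∈ Finset.Ioi i, (B l i + B i l) :=
        (Finset.sum_sum_Ioi_add_eq_sum_sum_off_diag B).symm
    _ = _ := by
        refine Finset.sum_congr rfl fun i _ => Finset.sum_congr rfl fun l _ => ?_
        rw [hBs l i]
        simp only [hB]; ring

end Arrays

/-! ### From the angle to the correlation -/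

theorem compIntegrand_nonneg {n r : ℕ} {h : ℝ} (hh : |h| ≤ 1) : 0 ≤ compIntegrand n r h := by
  have : 0 ≤ 1 - h ^ 2 := by
    have := (sq_le_one_iff_abs_le_one h).2 hh
    linarith
  unfold compIntegrand
  have := Real.rpow_nonneg this (((n : ℝ) - r + 1) / 2)
  positivity

theorem compConst_nonneg (n r : ℕ) (v : ℝ) : 0 ≤ compConst n r v := by
  unfold compConst
  have : 0 ≤ v ^ (2 * (n - r)) := Even.pow_nonneg (even_two_mul _) v
  positivity

theorem measurable_compIntegrand (n r : ℕ) : Measurable (compIntegrand n r) := by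
  unfold compIntegrand
  fun_prop

/-- Apart from collecting powers, the only loss is in the exponential, where `|h|` is enlarged to
`ρ` so that it no longer depends on the integration variable. -/
theorem pairBound_mul_tailBound_le {n r : ℕ} (hrn : r ≤ n) {h v ρ : ℝ} (hh : |h| < 1)
    (hρ : |h| ≤ ρ) :
    n * ((n - 1).choose (r - 1) : ℝ) ^ 2 * (pairBound h v * tailBound h v ^ (n - r))
      ≤ compConst n r v *
        (compIntegrand n r h * Real.exp (-(((n : ℝ) - r + 1) * v ^ 2 / (1 + ρ)))) := by
  have h0 := abs_nonneg h
  have hs : 0 < 1 - h ^ 2 := by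
    have := sq_lt_one_iff_abs_lt_one h |>.2 hh
    linarith
  obtain ⟨k, rfl⟩ := Nat.exists_eq_add_of_le hrn
  have hk : ((r + k : ℕ) : ℝ) - r + 1 = (k + 1 : ℕ) := by push_cast; ring
  rw [compConst, compIntegrand, hk, Nat.add_sub_cancel_left]
  have hpow : (1 - h ^ 2) ^ (((k + 1 : ℕ) : ℝ) / 2) = √(1 - h ^ 2) ^ (k + 1) := by
    rw [Real.sqrt_eq_rpow, ← Real.rpow_natCast ((1 - h ^ 2) ^ (1 / 2 : ℝ)), ← Real.rpow_mul hs.le]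
    congr 1; ring
  have hexp : Real.exp (-(v ^ 2 / (1 + |h|))) ^ (k + 1)
      ≤ Real.exp (-(((k + 1 : ℕ) : ℝ) * v ^ 2 / (1 + ρ))) := by
    rw [← Real.exp_nat_mul, Real.exp_le_exp, mul_neg, neg_le_neg_iff, mul_div_assoc]
    gcongr
  have e : pairBound h v * tailBound h v ^ k
      = ((2 * Real.pi) ^ (k + 1))⁻¹ * (v ^ (2 * k))⁻¹ *
        ((1 + |h|) ^ (2 * k) / √(1 - h ^ 2) ^ (k + 1)) *
        Real.exp (-(v ^ 2 / (1 + |h|))) ^ (k + 1) := by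
    rw [tailBound, mul_pow, ← mul_assoc, ← pow_succ', ← pow_mul, pairBound, div_pow, div_pow,
      mul_pow (2 * Real.pi)]
    simp only [div_eq_mul_inv, mul_inv]
    ring
  rw [e, hpow]
  calc _ = (((r + k : ℕ) : ℝ) * ((r + k - 1).choose (r - 1) : ℝ) ^ 2 / (2 * Real.pi) ^ (k + 1) *
          (v ^ (2 * k))⁻¹) * ((1 + |h|) ^ (2 * k) / √(1 - h ^ 2) ^ (k + 1) *
          Real.exp (-(v ^ 2 / (1 + |h|))) ^ (k + 1)) := by ring
    _ ≤ _ := by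
        have : 0 ≤ v ^ (2 * k) := Even.pow_nonneg (even_two_mul _) v
        gcongr

/-- No integrability is assumed: a non-integrable function has Bochner integral `0`. -/
theorem ofReal_integral_le {α : Type*} [MeasurableSpace α] {μ : Measure α} (f : α → ℝ) :
    ENNReal.ofReal (∫ x, f x ∂μ) ≤ ∫⁻ x, ENNReal.ofReal (f x) ∂μ := by
  by_cases hf : Integrable f μ
  · rw [integral_eq_lintegral_pos_part_sub_lintegral_neg_part hf]
    refine (ENNReal.ofReal_le_ofReal (sub_le_self _ ENNReal.toReal_nonneg)).trans ?_
    exact ENNReal.ofReal_toReal_le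
  · simp [integral_undef hf]

/-- The substitution `h = sin² θ s₁ + cos² θ s₀`. -/
theorem lintegral_substitution_le (s₁ s₀ : ℝ) (g : ℝ → ENNReal) :
    ∫⁻ θ in Set.Ioo 0 (Real.pi / 2),
      ENNReal.ofReal (2 * (Real.sin θ * Real.cos θ) * max (s₁ - s₀) 0) *
        g (Real.sin θ ^ 2 * s₁ + Real.cos θ ^ 2 * s₀) ≤ ∫⁻ h in Set.Ioc s₀ s₁, g h := by
  rcases le_or_gt s₁ s₀ with hle | hlt
  · rw [max_eq_right (by linarith)]; simp
  rw [max_eq_left (by linarith)]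
  set c : ℝ → ℝ := fun θ => Real.sin θ ^ 2 * s₁ + Real.cos θ ^ 2 * s₀ with hc
  have hce : ∀ θ, c θ = s₀ + Real.sin θ ^ 2 * (s₁ - s₀) := fun θ => by
    have := Real.sin_sq_add_cos_sq θ
    simp only [hc]
    rw [show Real.cos θ ^ 2 = 1 - Real.sin θ ^ 2 by linarith]; ring
  have hd : ∀ θ, HasDerivAt c (2 * (Real.sin θ * Real.cos θ) * (s₁ - s₀)) θ := fun θ => by
    have h := ((((Real.hasDerivAt_sin θ).pow 2).mul_const (s₁ - s₀))).const_add s₀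
    have ec : c = fun θ => s₀ + Real.sin θ ^ 2 * (s₁ - s₀) := funext hce
    rw [ec]
    convert! h using 1
    simp only [Nat.cast_ofNat]; ring
  have hsin : ∀ θ ∈ Set.Ioo 0 (Real.pi / 2), 0 < Real.sin θ := fun θ hθ =>
    Real.sin_pos_of_pos_of_lt_pi hθ.1 (by linarith [hθ.2, Real.pi_pos])
  have hcos : ∀ θ ∈ Set.Ioo 0 (Real.pi / 2), 0 < Real.cos θ := fun θ hθ =>
    Real.cos_pos_of_mem_Ioo ⟨by linarith [hθ.1, Real.pi_pos], hθ.2⟩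
  -- Injectivity permits the change of variables for an arbitrary `g`; the inclusion of the image in
  -- the interval is enough for an upper bound.
  have hinj : Set.InjOn c (Set.Ioo 0 (Real.pi / 2)) := by
    intro x hx y hy hxy
    rw [hce, hce] at hxy
    have h1 : Real.sin x ^ 2 = Real.sin y ^ 2 := by
      have : s₁ - s₀ ≠ 0 := by linarith
      exact mul_right_cancel₀ this (by linarith)
    have h2 : Real.sin x = Real.sin y :=
      (sq_eq_sq₀ (hsin x hx).le (hsin y hy).le).1 h1
    exact Real.injOn_sin ⟨by linarith [hx.1, Real.pi_pos], hx.2.le⟩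
      ⟨by linarith [hy.1, Real.pi_pos], hy.2.le⟩ h2
  have himg : c '' Set.Ioo 0 (Real.pi / 2) ⊆ Set.Ioc s₀ s₁ := by
    rintro _ ⟨θ, hθ, rfl⟩
    rw [hce]
    have h1 : 0 < Real.sin θ ^ 2 := by have := hsin θ hθ; positivity
    have h2 : Real.sin θ ^ 2 ≤ 1 := by
      have := Real.sin_sq_add_cos_sq θ
      nlinarith [sq_nonneg (Real.cos θ)]
    constructor <;> nlinarith
  calc _ = ∫⁻ θ in Set.Ioo 0 (Real.pi / 2),
        ENNReal.ofReal |2 * (Real.sin θ * Real.cos θ) * (s₁ - s₀)| * g (c θ) := by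
        refine setLIntegral_congr_fun measurableSet_Ioo fun θ hθ => ?_
        rw [abs_of_nonneg]
        have := hsin θ hθ
        have := hcos θ hθ
        have : 0 < s₁ - s₀ := by linarith
        positivity
    _ = ∫⁻ h in c '' Set.Ioo 0 (Real.pi / 2), g h :=
        (lintegral_image_eq_lintegral_abs_deriv_mul measurableSet_Ioo
          (fun θ _ => (hd θ).hasDerivWithinAt) hinj g).symm
    _ ≤ _ := lintegral_mono_set himg

section Arrays

variable {d n : ℕ} {μ₁ μ₀ : Measure (Fin d × Fin n → ℝ)} {σ₁ σ₀ : Fin d → Fin d → ℝ}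

theorem abs_interp_le {s₁ s₀ : ℝ} (θ : ℝ) :
    |Real.sin θ ^ 2 * s₁ + Real.cos θ ^ 2 * s₀| ≤ max |s₀| |s₁| := by
  have h := Real.sin_sq_add_cos_sq θ
  have h1 := le_max_left |s₀| |s₁|
  have h2 := le_max_right |s₀| |s₁|
  calc |Real.sin θ ^ 2 * s₁ + Real.cos θ ^ 2 * s₀|
      ≤ Real.sin θ ^ 2 * |s₁| + Real.cos θ ^ 2 * |s₀| := by
        refine (abs_add_le _ _).trans (le_of_eq ?_)
        rw [abs_mul, abs_mul, abs_of_nonneg (sq_nonneg (Real.sin θ)),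
          abs_of_nonneg (sq_nonneg (Real.cos θ))]
    _ ≤ Real.sin θ ^ 2 * max |s₀| |s₁| + Real.cos θ ^ 2 * max |s₀| |s₁| := by gcongr
    _ = max |s₀| |s₁| := by rw [← add_mul, h, one_mul]

/-- The comparison inequality for the smoothed distribution functions. -/
theorem ofReal_smooth_sub_le [NeZero n] (h₁ : IsStdGaussian μ₁ (columnMoment σ₁))
    (h₀ : IsStdGaussian μ₀ (columnMoment σ₀)) {r : ℕ} (hr : 1 ≤ r) (hrn : r ≤ n) (m : ℕ)
    {u : Fin d → ℝ} {v : ℝ} (hv : 0 < v) (hvu : ∀ i, v ≤ u i) :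
    ENNReal.ofReal (∫ x, rowPoly r (fun a => smoothCutoff m (u a.1) (x a)) ∂μ₁
        - ∫ x, rowPoly r (fun a => smoothCutoff m (u a.1) (x a)) ∂μ₀)
      ≤ ENNReal.ofReal (compConst n r v) * ∑ i, ∑ l ∈ Finset.Ioi i,
        (∫⁻ h in Set.Ioc (σ₀ i l) (σ₁ i l), ENNReal.ofReal (compIntegrand n r h)) *
        ENNReal.ofReal (Real.exp (-(((n : ℝ) - r + 1) * v ^ 2 /
          (1 + max |σ₀ i l| |σ₁ i l|)))) := by
  set e : Fin d → Fin d → ℝ := fun i l => Real.exp (-(((n : ℝ) - r + 1) * v ^ 2 /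
          (1 + max |σ₀ i l| |σ₁ i l|))) with he
  set c : Fin d → Fin d → ℝ → ℝ := fun i l θ =>
    Real.sin θ ^ 2 * σ₁ i l + Real.cos θ ^ 2 * σ₀ i l with hc
  rw [integral_sub_integral_eq h₁ h₀ (multiAffine_rowPoly r)
    (ψ := fun a => smoothCutoff m (u a.1)) (ψ' := fun a => deriv (smoothCutoff m (u a.1)))
    (fun a => (isTailCutoff_smoothCutoff m (u a.1)).toIsCutoff),
    intervalIntegral.integral_of_le (by positivity), integral_Ioc_eq_integral_Ioo]
  refine (ofReal_integral_le _).trans ?_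
  have hle : ∀ θ ∈ Set.Ioo 0 (Real.pi / 2), ENNReal.ofReal (∑ a, ∑ b, Real.sin θ * Real.cos θ *
        (columnMoment σ₁ a b - columnMoment (n := n) σ₀ a b) * mixedTerm μ₁ μ₀ r m u θ a b)
      ≤ ∑ i, ∑ l ∈ Finset.Ioi i, (ENNReal.ofReal (compConst n r v) * ENNReal.ofReal (e i l)) *
        (ENNReal.ofReal (2 * (Real.sin θ * Real.cos θ) * max (σ₁ i l - σ₀ i l) 0) *
          ENNReal.ofReal (compIntegrand n r (c i l θ))) := by
    intro θ hθ
    have hs : 0 < Real.sin θ := Real.sin_pos_of_pos_of_lt_pi hθ.1 (by linarith [hθ.2, Real.pi_pos])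
    have hcs : 0 < Real.cos θ := Real.cos_pos_of_mem_Ioo ⟨by linarith [hθ.1, Real.pi_pos], hθ.2⟩
    have hC := compConst_nonneg n r v
    have hint : ∀ i l, 0 ≤ compIntegrand n r (c i l θ) := fun i l =>
      compIntegrand_nonneg ((abs_interp_le θ).trans
        (max_le (abs_le_one_of_isStdGaussian h₀ i l) (abs_le_one_of_isStdGaussian h₁ i l)))
    have hw : ∀ i l, 0 ≤ 2 * (Real.sin θ * Real.cos θ) * max (σ₁ i l - σ₀ i l) 0 := fun i l =>
      mul_nonneg (by positivity) (le_max_right _ _)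
    have hterm : ∀ i l, 2 * (Real.sin θ * Real.cos θ) * max (σ₁ i l - σ₀ i l) 0 *
        (n * ((n - 1).choose (r - 1) : ℝ) ^ 2 *
          (pairBound (c i l θ) v * tailBound (c i l θ) v ^ (n - r)))
        ≤ (compConst n r v * e i l) * (2 * (Real.sin θ * Real.cos θ) *
          max (σ₁ i l - σ₀ i l) 0 * compIntegrand n r (c i l θ)) := by
      intro i l
      rcases le_or_gt (σ₁ i l) (σ₀ i l) with hle | hlt
      · rw [max_eq_right (by linarith)]; simp
      · have a1 := abs_le.1 (abs_le_one_of_isStdGaussian h₁ i l)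
        have a0 := abs_le.1 (abs_le_one_of_isStdGaussian h₀ i l)
        have hh : |c i l θ| < 1 := by
          have hs2 : 0 < Real.sin θ ^ 2 := by positivity
          have hc2 : 0 < Real.cos θ ^ 2 := by positivity
          have hsc : Real.sin θ ^ 2 + Real.cos θ ^ 2 = 1 := Real.sin_sq_add_cos_sq θ
          rw [abs_lt]
          simp only [hc]
          constructor <;> nlinarith
        have := mul_le_mul_of_nonneg_left (pairBound_mul_tailBound_le (v := v) hrn hh
          (abs_interp_le (s₁ := σ₁ i l) (s₀ := σ₀ i l) θ)) (hw i l)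
        refine this.trans (le_of_eq ?_)
        simp only [he]; ring
    refine (ENNReal.ofReal_le_ofReal (sum_mixedTerm_le h₁ h₀ hr m hv hvu hθ)).trans ?_
    refine (ENNReal.ofReal_le_ofReal (Finset.sum_le_sum fun i _ => Finset.sum_le_sum fun l _ =>
      hterm i l)).trans (le_of_eq ?_)
    have hnn : ∀ i l, 0 ≤ (compConst n r v * e i l) * (2 * (Real.sin θ * Real.cos θ) *
          max (σ₁ i l - σ₀ i l) 0 * compIntegrand n r (c i l θ)) := fun i l =>
      mul_nonneg (mul_nonneg hC (Real.exp_pos _).le) (mul_nonneg (hw i l) (hint i l))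
    rw [ENNReal.ofReal_sum_of_nonneg fun i _ => Finset.sum_nonneg fun l _ => hnn i l]
    refine Finset.sum_congr rfl fun i _ => ?_
    rw [ENNReal.ofReal_sum_of_nonneg fun l _ => hnn i l]
    refine Finset.sum_congr rfl fun l _ => ?_
    rw [ENNReal.ofReal_mul (mul_nonneg hC (Real.exp_pos _).le), ENNReal.ofReal_mul hC,
      ENNReal.ofReal_mul (hw i l)]
  have hmeas : ∀ i l, Measurable fun θ =>
      ENNReal.ofReal (2 * (Real.sin θ * Real.cos θ) * max (σ₁ i l - σ₀ i l) 0) *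
          ENNReal.ofReal (compIntegrand n r (c i l θ)) := by
    intro i l
    have hsc : Measurable fun θ => ENNReal.ofReal (2 * (Real.sin θ * Real.cos θ) *
        max (σ₁ i l - σ₀ i l) 0) := by fun_prop
    refine hsc.mul ?_
    have hcm : Measurable (c i l) := by simp only [hc]; fun_prop
    exact ((measurable_compIntegrand n r).comp hcm).ennreal_ofReal
  refine (setLIntegral_mono' measurableSet_Ioo hle).trans ?_
  rw [lintegral_finsetSum _ fun i _ => Finset.measurable_sum _ fun l _ =>
    (hmeas i l).const_mul _, Finset.mul_sum]
  refine Finset.sum_le_sum fun i _ => ?_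
  rw [lintegral_finsetSum _ fun l _ => (hmeas i l).const_mul _, Finset.mul_sum]
  refine Finset.sum_le_sum fun l _ => ?_
  rw [lintegral_const_mul _ (hmeas i l), mul_assoc, mul_comm (lintegral _ _)]
  exact mul_le_mul_right (mul_le_mul_right (lintegral_substitution_le (σ₁ i l) (σ₀ i l)
    fun h => ENNReal.ofReal (compIntegrand n r h)) _) _

/-! ### Removing the smoothing and returning to order statistics -/

/-- The arrays whose `r`-th order statistics are at most `u`, in terms of counts. -/
def countSet (n r : ℕ) (u : Fin d → ℝ) : Set (Fin d × Fin n → ℝ) :=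
  {x | ∀ i, r ≤ (Finset.univ.filter fun j => x (i, j) ≤ u i).card}

theorem measurableSet_countSet (r : ℕ) (u : Fin d → ℝ) : MeasurableSet (countSet n r u) := by
  have e : countSet n r u = ⋂ i, {x | r ≤ (Finset.univ.filter fun j => x (i, j) ≤ u i).card} := by
    ext x; simp [countSet]
  rw [e]
  refine MeasurableSet.iInter fun i => measurableSet_le measurable_const ?_
  simp only [Finset.card_filter]
  refine Finset.measurable_sum _ fun j _ => Measurable.ite ?_ measurable_const measurable_const
  exact measurableSet_le (measurable_pi_apply _) measurable_const

theorem rowPoly_indicator (r : ℕ) (u : Fin d → ℝ) (x : Fin d × Fin n → ℝ) :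
    rowPoly r (fun a => if x a ≤ u a.1 then 1 else 0) = (countSet n r u).indicator 1 x := by
  have h : ∀ i, countPoly r (fun j : Fin n => if x (i, j) ≤ u i then (1 : ℝ) else 0)
      = if r ≤ (Finset.univ.filter fun j => x (i, j) ≤ u i).card then 1 else 0 := by
    intro i
    rw [← countPoly_indicator]
    simp
  simp only [rowPoly, h]
  by_cases hx : x ∈ countSet n r u
  · rw [Set.indicator_of_mem hx]
    exact Finset.prod_eq_one fun i _ => if_pos (hx i)
  · rw [Set.indicator_of_notMem hx]
    simp only [countSet, Set.mem_ofPred_eq, not_forall] at hx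
    obtain ⟨i, hi⟩ := hx
    exact Finset.prod_eq_zero (Finset.mem_univ i) (if_neg hi)

/-- At a fixed point all the finitely many cutoffs eventually equal the indicators exactly, and the
integrands lie in `[0, 1]`, so dominated convergence applies. No continuity of the distribution is
involved. -/
theorem tendsto_integral_rowPoly (μ : Measure (Fin d × Fin n → ℝ)) [IsProbabilityMeasure μ]
    (r : ℕ) (u : Fin d → ℝ) :
    Filter.Tendsto (fun m : ℕ => ∫ x, rowPoly r (fun a => smoothCutoff m (u a.1) (x a)) ∂μ)
      Filter.atTop (nhds (μ.real (countSet n r u))) := by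
  rw [← integral_indicator_one (measurableSet_countSet r u)]
  refine tendsto_integral_of_dominated_convergence (fun _ => 1) (fun m => ?_)
    (integrable_const 1) (fun m => ae_of_all _ fun x => ?_) (ae_of_all _ fun x => ?_)
  · refine Continuous.aestronglyMeasurable ((multiAffine_rowPoly r).continuous.comp ?_)
    exact continuous_pi fun a => (isTailCutoff_smoothCutoff m _).continuous.comp
      (continuous_apply a)
  · have h : ∀ i, countPoly r (fun j : Fin n => smoothCutoff m (u i) (x (i, j))) ∈
        Set.Icc (0 : ℝ) 1 := fun i => countPoly_mem (fun j => smoothCutoff_mem m _ _) r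
    rw [rowPoly, Real.norm_eq_abs, abs_of_nonneg (Finset.prod_nonneg fun i _ => (h i).1)]
    exact Finset.prod_le_one (fun i _ => (h i).1) fun i _ => (h i).2
  · rw [← rowPoly_indicator]
    refine tendsto_const_nhds.congr' ?_
    filter_upwards [Filter.eventually_all.2 fun a : Fin d × Fin n =>
      eventually_smoothCutoff_eq (u a.1) (x a)] with m hm
    simp only [hm]

theorem ofReal_countSet_sub_le [NeZero n] (h₁ : IsStdGaussian μ₁ (columnMoment σ₁))
    (h₀ : IsStdGaussian μ₀ (columnMoment σ₀)) {r : ℕ} (hr : 1 ≤ r) (hrn : r ≤ n)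
    {u : Fin d → ℝ} {v : ℝ} (hv : 0 < v) (hvu : ∀ i, v ≤ u i) :
    ENNReal.ofReal (μ₁.real (countSet n r u) - μ₀.real (countSet n r u))
      ≤ ENNReal.ofReal (compConst n r v) * ∑ i, ∑ l ∈ Finset.Ioi i,
        (∫⁻ h in Set.Ioc (σ₀ i l) (σ₁ i l), ENNReal.ofReal (compIntegrand n r h)) *
        ENNReal.ofReal (Real.exp (-(((n : ℝ) - r + 1) * v ^ 2 /
          (1 + max |σ₀ i l| |σ₁ i l|)))) := by
  have := h₁.isGaussian
  have := h₀.isGaussian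
  exact le_of_tendsto ((ENNReal.continuous_ofReal.tendsto _).comp
    ((tendsto_integral_rowPoly μ₁ r u).sub (tendsto_integral_rowPoly μ₀ r u)))
    (Filter.Eventually.of_forall fun m => ofReal_smooth_sub_le h₁ h₀ hr hrn m hv hvu)

/-- Sorting permutes the entries and so preserves the count; in the sorted tuple, the entry of index
`r - 1` is at most `t` exactly when `r - 1` is less than the count. -/
theorem orderStat_le_iff (x : Fin n → ℝ) (r : ℕ) (hr : 1 ≤ r) (hrn : r ≤ n) (t : ℝ) :
    orderStat x r hr hrn ≤ t ↔ r ≤ (Finset.univ.filter fun j => x j ≤ t).card := by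
  have h := Tuple.lt_card_le_iff_apply_le_of_monotone (j := (⟨r - 1, by omega⟩ : Fin n)) (a := t)
    (Tuple.monotone_sort x)
  have e : (Finset.univ.filter fun j => (x ∘ Tuple.sort x) j ≤ t).card
      = (Finset.univ.filter fun j => x j ≤ t).card :=
    Finset.card_equiv (Tuple.sort x) fun j => by simp
  rw [e] at h
  simp only [orderStat]
  rw [Function.comp_apply] at h
  rw [← h]
  simp only
  omega

variable {Ω : Type*} [MeasurableSpace Ω] {P : Measure Ω} {X : Fin d → Fin n → Ω → ℝ}

theorem orderStatCDF_eq (hX : IsStdGaussianArray X P) (r : ℕ) (hr : 1 ≤ r)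
    (hrn : r ≤ n) (u : Fin d → ℝ) :
    orderStatCDF X P r hr hrn u
      = (P.map fun ω (p : Fin d × Fin n) => X p.1 p.2 ω).real (countSet n r u) := by
  rw [Measure.real, Measure.map_apply_of_aemeasurable hX.gaussian.aemeasurable
    (measurableSet_countSet r u), orderStatCDF, Measure.real]
  congr 2
  ext ω
  simp only [orderStat_le_iff]
  rfl

theorem isStdGaussian_map {σ : Fin d → Fin d → ℝ} (hX : IsStdGaussianArray X P)
    (hσ : ∀ i l j k, ∫ ω, X i j ω * X l k ω ∂P = if j = k then σ i l else 0) :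
    IsStdGaussian (P.map fun ω (p : Fin d × Fin n) => X p.1 p.2 ω) (columnMoment σ) where
  isGaussian := hX.gaussian.isGaussian_map
  mean a := by
    rw [integral_map hX.gaussian.aemeasurable (measurable_pi_apply a).aestronglyMeasurable]
    simpa using (hX.standard a.1 a.2).integral_eq
  moment a b := by
    rw [integral_map hX.gaussian.aemeasurable (by fun_prop)]
    exact hσ a.1 b.1 a.2 b.2
  diag a := by
    have h := hσ a.1 a.1 a.2 a.2
    have hL := hX.standard a.1 a.2
    have hP : IsProbabilityMeasure P := hX.gaussian.isProbabilityMeasure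
    have hm : MemLp (X a.1 a.2) 2 P := (hX.gaussian.eval a).memLp_two
    have hv : Var[X a.1 a.2; P] = 1 := by
      rw [hL.variance_eq, variance_id_gaussianReal]; simp
    have h0 : ∫ ω, X a.1 a.2 ω ∂P = 0 := by simpa using hL.integral_eq
    rw [← covariance_self hL.aemeasurable, covariance_eq_sub hm hm, h0] at hv
    simp only [Pi.mul_apply] at hv
    rw [h] at hv
    simpa [columnMoment] using hv

end Arrays

/-! ### Passage from `ENNReal` to `EReal` -/

section Extended

theorem abs_coe_ennreal (x : ENNReal) : (x : EReal).abs = x := by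
  induction x with
  | top => simp
  | coe x => rw [EReal.coe_nnreal_eq_coe_real, EReal.abs_def, abs_of_nonneg x.coe_nonneg,
      ENNReal.ofReal_coe_nnreal]

theorem compIntegral_of_le (n r : ℕ) {a b : ℝ} (hab : a ≤ b) :
    compIntegral n r a b
      = ((∫⁻ h in Set.Ioc a b, ENNReal.ofReal (compIntegrand n r h) : ENNReal) : EReal) := by
  rw [compIntegral, Set.Ioc_eq_empty (not_lt.2 hab)]
  simp

theorem compIntegral_of_ge (n r : ℕ) {a b : ℝ} (hab : b ≤ a) :
    compIntegral n r a b
      = -((∫⁻ h in Set.Ioc b a, ENNReal.ofReal (compIntegrand n r h) : ENNReal) : EReal) := by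
  rw [compIntegral, Set.Ioc_eq_empty (not_lt.2 hab)]
  simp

theorem coe_lintegral_le_max (n r : ℕ) (a b : ℝ) :
    ((∫⁻ h in Set.Ioc a b, ENNReal.ofReal (compIntegrand n r h) : ENNReal) : EReal)
      ≤ max (compIntegral n r a b) 0 := by
  rcases le_total a b with hab | hab
  · rw [compIntegral_of_le n r hab]; exact le_max_left _ _
  · rw [Set.Ioc_eq_empty (not_lt.2 hab)]; simp

theorem lintegral_le_abs (n r : ℕ) (a b : ℝ) :
    ∫⁻ h in Set.Ioc a b, ENNReal.ofReal (compIntegrand n r h) ≤ (compIntegral n r a b).abs := by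
  rcases le_total a b with hab | hab
  · rw [compIntegral_of_le n r hab, abs_coe_ennreal]
  · rw [Set.Ioc_eq_empty (not_lt.2 hab)]; simp

theorem lintegral_swap_le_abs (n r : ℕ) (a b : ℝ) :
    ∫⁻ h in Set.Ioc b a, ENNReal.ofReal (compIntegrand n r h) ≤ (compIntegral n r a b).abs := by
  rcases le_total a b with hab | hab
  · rw [Set.Ioc_eq_empty (not_lt.2 hab)]; simp
  · rw [compIntegral_of_ge n r hab, EReal.abs_neg, abs_coe_ennreal]

theorem coe_ennreal_sum {α : Type*} (s : Finset α) (f : α → ENNReal) :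
    ((∑ a ∈ s, f a : ENNReal) : EReal) = ∑ a ∈ s, (f a : EReal) := by
  classical
  induction s using Finset.induction_on with
  | empty => simp
  | insert a s ha ih => rw [Finset.sum_insert ha, Finset.sum_insert ha, EReal.coe_ennreal_add, ih]

theorem coe_le_of_ofReal_le {x : ℝ} {y : ENNReal} (h : ENNReal.ofReal x ≤ y) :
    (x : EReal) ≤ (y : EReal) := by
  calc (x : EReal) ≤ ((max x 0 : ℝ) : EReal) := by exact_mod_cast le_max_left x 0
    _ = ((ENNReal.ofReal x : ENNReal) : EReal) := (EReal.coe_ennreal_ofReal).symm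
    _ ≤ y := by exact_mod_cast h

theorem coe_ofReal_of_nonneg {x : ℝ} (hx : 0 ≤ x) :
    ((ENNReal.ofReal x : ENNReal) : EReal) = (x : EReal) := by
  rw [EReal.coe_ennreal_ofReal, max_eq_left hx]

end Extended

/-- The upper bound for the difference of the distribution functions, in `ENNReal`. -/
theorem ofReal_orderStatCDF_sub_le {Ω Ω' : Type*} [MeasurableSpace Ω] [MeasurableSpace Ω']
    {P : Measure Ω} {P' : Measure Ω'} {d n r : ℕ} (hr₁ : 1 ≤ r) (hrn : r ≤ n)
    {X : Fin d → Fin n → Ω → ℝ} {Y : Fin d → Fin n → Ω' → ℝ}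
    (hX : IsStdGaussianArray X P) (hY : IsStdGaussianArray Y P')
    {σ₁ σ₀ : Fin d → Fin d → ℝ}
    (hσ₁ : ∀ i l j k, ∫ ω, X i j ω * X l k ω ∂P = if j = k then σ₁ i l else 0)
    (hσ₀ : ∀ i l j k, ∫ ω, Y i j ω * Y l k ω ∂P' = if j = k then σ₀ i l else 0)
    {u : Fin d → ℝ} {v : ℝ} (hv : 0 < v) (hvu : ∀ i, v ≤ u i) :
    ENNReal.ofReal (orderStatCDF X P r hr₁ hrn u - orderStatCDF Y P' r hr₁ hrn u)
      ≤ ENNReal.ofReal (compConst n r v) * ∑ i, ∑ l ∈ Finset.Ioi i,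
        (∫⁻ h in Set.Ioc (σ₀ i l) (σ₁ i l), ENNReal.ofReal (compIntegrand n r h)) *
        ENNReal.ofReal (Real.exp (-(((n : ℝ) - r + 1) * v ^ 2 /
          (1 + max |σ₀ i l| |σ₁ i l|)))) := by
  have : NeZero n := ⟨by omega⟩
  rw [orderStatCDF_eq hX, orderStatCDF_eq hY]
  exact ofReal_countSet_sub_le (isStdGaussian_map hX hσ₁) (isStdGaussian_map hY hσ₀) hr₁ hrn hv hvu

end GaussianComparison

end

open GaussianComparison

theorem mainTheorem3 {Ω Ω' : Type*} [MeasurableSpace Ω] [MeasurableSpace Ω']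
    (P : Measure Ω) [IsProbabilityMeasure P] (P' : Measure Ω') [IsProbabilityMeasure P']
    {d n : ℕ} [NeZero d] (r : ℕ) (hr₁ : 1 ≤ r) (hrn : r ≤ n)
    (X : Fin d → Fin n → Ω → ℝ) (Y : Fin d → Fin n → Ω' → ℝ)
    (hX : IsStdGaussianArray X P) (hY : IsStdGaussianArray Y P')
    (σ₁ σ₀ : Fin d → Fin d → ℝ)
    (hσ₁ : ∀ i l j k, ∫ ω, X i j ω * X l k ω ∂P = if j = k then σ₁ i l else 0)
    (hσ₀ : ∀ i l j k, ∫ ω, Y i j ω * Y l k ω ∂P' = if j = k then σ₀ i l else 0)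
    (u : Fin d → ℝ) (hu : ∀ i, 0 < u i) :
    let Δ : ℝ := orderStatCDF X P r hr₁ hrn u - orderStatCDF Y P' r hr₁ hrn u
    let v : ℝ := Finset.univ.inf' Finset.univ_nonempty u
    let ρ : Fin d → Fin d → ℝ := fun i l => max |σ₀ i l| |σ₁ i l|
    let A : Fin d → Fin d → EReal := fun i l => compIntegral n r (σ₀ i l) (σ₁ i l)
    let e : Fin d → Fin d → ℝ := fun i l => Real.exp (-(((n : ℝ) - r + 1) * v ^ 2 / (1 + ρ i l)))
    ((Δ : ℝ) : EReal) ≤ (compConst n r v : EReal) *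
        ∑ i, ∑ l ∈ Finset.Ioi i, max (A i l) 0 * (e i l : EReal) ∧
    ((|Δ| : ℝ) : EReal) ≤ (compConst n r v : EReal) *
        ∑ i, ∑ l ∈ Finset.Ioi i, ((A i l).abs : EReal) * (e i l : EReal) := by
  intro Δ v ρ A e
  have hv : 0 < v := (Finset.lt_inf'_iff _).2 fun i _ => hu i
  have hvu : ∀ i, v ≤ u i := fun i => Finset.inf'_le _ (Finset.mem_univ i)
  have h₁ := ofReal_orderStatCDF_sub_le hr₁ hrn hX hY hσ₁ hσ₀ hv hvu
  have h₂ := ofReal_orderStatCDF_sub_le hr₁ hrn hY hX hσ₀ hσ₁ hv hvu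
  have hC := compConst_nonneg n r v
  have he : ∀ i l, 0 ≤ e i l := fun i l => (Real.exp_pos _).le
  constructor
  · refine (coe_le_of_ofReal_le h₁).trans ?_
    rw [EReal.coe_ennreal_mul, coe_ofReal_of_nonneg hC, coe_ennreal_sum]
    refine mul_le_mul_of_nonneg_left (Finset.sum_le_sum fun i _ => ?_) (by exact_mod_cast hC)
    rw [coe_ennreal_sum]
    refine Finset.sum_le_sum fun l _ => ?_
    rw [EReal.coe_ennreal_mul, coe_ofReal_of_nonneg (he i l)]
    exact mul_le_mul_of_nonneg_right (coe_lintegral_le_max n r _ _) (by exact_mod_cast he i l)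
  -- According to the sign of `Δ`, the one-sided bound is used for the arrays as given or exchanged.
  -- Either way the oriented piece that occurs is at most `(A i l).abs`, and the exponential weight
  -- is symmetric in `σ₀`, `σ₁`.
  · have habs : ENNReal.ofReal |Δ| ≤ ENNReal.ofReal (compConst n r v) * ∑ i, ∑ l ∈ Finset.Ioi i,
        (A i l).abs * ENNReal.ofReal (e i l) := by
      rcases abs_choice Δ with h | h
      · rw [h]
        refine h₁.trans ?_
        gcongr with i _ l _
        exact lintegral_le_abs n r _ _
      · rw [h, neg_sub]
        refine h₂.trans ?_
        simp only [max_comm |σ₁ _ _| |σ₀ _ _|]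
        gcongr with i _ l _
        exact lintegral_swap_le_abs n r _ _
    refine (coe_le_of_ofReal_le habs).trans (le_of_eq ?_)
    rw [EReal.coe_ennreal_mul, coe_ofReal_of_nonneg hC, coe_ennreal_sum]
    simp only [coe_ennreal_sum, EReal.coe_ennreal_mul, coe_ofReal_of_nonneg (he _ _)]
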